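/- Throughout, ``simplicial $2$-complex'' means a finite connected simplicial complex of dimension at most $2$. For a group $G$, the simplicial complexity $\kappa(G)$ is the minimal number of $2$-simplices of a simplicial $2$-complex $X$ with $\pi_1(X)\cong G$ (and $\kappa(G)=\infty$ if there is no such $X$, that is, if $G$ is not finitely presentable). The free index of a finitely presentable group $G$ is the unique integer $n\ge 0$ such that $G\cong H*F_n$, where $F_n$ is the free group of rank $n$ and $H$ is a group that is not isomorphic to any free product $K*F_m$ with $m\ge 1$; so $G$ has free index zero if and only if it has no free factor $\mathbb{Z}$. For a positive integer $T$, let $\mathcal{G}_\kappa(T)$ be the set of isomorphism classes of groups $G$ of free index zero with $\kappa(G)\le T$, and let $\mathcal{A}_\kappa(T)\subset\mathcal{G}_\kappa(T)$ be the subset of isomorphism classes of finite abelian groups. **Theorem.** For every integer $T\ge 2$ the set $\mathcal{G}_\kappa(T)$ is finite, and $$\left[2^{\frac{T-3}{14}}\right]\le|\mathcal{A}_\kappa(T)|\le|\mathcal{G}_\kappa(T)|\le 2^{6T\log_2 T},$$ where $[x]$ denotes the integral part of the real number $x$. -/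

import Mathlib

namespace SimplicialComplexity

/-- The geometric realization of a simplicial complex `K` with finite vertex set `ι`: the set of all
points of the standard simplex spanned by `ι` (in barycentric coordinates) whose support is
contained in a face of `K`. It carries the topology induced from `ι → ℝ`. -/
def realization {ι : Type} [Fintype ι] (K : AbstractSimplicialComplex ι) : Set (ι → ℝ) :=
  {x | x ∈ stdSimplex ℝ ι ∧ ∃ s ∈ K.faces, ∀ v, v ∉ s → x v = 0}

/-- The number `s_k(K)` of `k`-simplices of a finite simplicial complex `K`. -/
noncomputable def numSimplices {ι : Type} [Fintype ι] (K : AbstractSimplicialComplex ι) (k : ℕ) :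
    ℕ :=
  {s : Finset ι | s ∈ K.faces ∧ s.card = k + 1}.ncard

/-- `K` is a (connected) simplicial complex of dimension at most two whose geometric realization
has fundamental group isomorphic to `G`. -/
def IsTwoComplexFor {ι : Type} [Fintype ι] (K : AbstractSimplicialComplex ι)
    (G : Type*) [Group G] : Prop :=
  (∀ s ∈ K.faces, s.card ≤ 3) ∧
    PathConnectedSpace (realization K) ∧
    ∃ x : realization K, Nonempty (FundamentalGroup (realization K) x ≃* G)

/-- The simplicial complexity `κ(G)`: the infimum of the number of `2`-simplices over all finite
simplicial `2`-complexes with fundamental group `G`. The infimum is taken in `ℕ∞`, so `κ(G) = ⊤`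
exactly when there is no such complex, i.e. when `G` is not finitely presentable. -/
noncomputable def kappa (G : Type*) [Group G] : ℕ∞ :=
  sInf {k : ℕ∞ | ∃ (ι : Type) (_ : Fintype ι) (K : AbstractSimplicialComplex ι),
    IsTwoComplexFor K G ∧ k = (numSimplices K 2 : ℕ∞)}

/-- `H` cannot be decomposed as a free product `K * F_n` with `n` positive. -/
def HasNoFreeFactor (H : Type) [Group H] : Prop :=
  ∀ (K : Type) [Group K] (n : ℕ), 0 < n → IsEmpty (H ≃* Monoid.Coprod K (FreeGroup (Fin n)))

/-- The free index of `G` is `n`: `G = H * F_n` where `H` itself cannot be decomposed as a free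
product `K * F_m` with `m` positive. -/
def HasFreeIndex (G : Type) [Group G] (n : ℕ) : Prop :=
  ∃ (H : Type) (_ : Group H),
    Nonempty (G ≃* Monoid.Coprod H (FreeGroup (Fin n))) ∧ HasNoFreeFactor H

/-- Isomorphism classes of groups. -/
abbrev GroupClass : Type 1 := Quotient (CategoryTheory.isIsomorphicSetoid GrpCat.{0})

/-- The isomorphism class of a group. -/
def groupClass (G : Type) [Group G] : GroupClass :=
  Quotient.mk (CategoryTheory.isIsomorphicSetoid GrpCat.{0}) (GrpCat.of G)

/-- `𝒢_κ(T)`: the isomorphism classes of groups `G` of free index zero with `κ(G) ≤ T`. -/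
def groupsUpTo (T : ℕ) : Set GroupClass :=
  {c | ∃ (G : Type) (_ : Group G), c = groupClass G ∧ HasFreeIndex G 0 ∧ kappa G ≤ (T : ℕ∞)}

/-- `𝒜_κ(T)`: the subset of `𝒢_κ(T)` corresponding to finite abelian groups. -/
def abelianGroupsUpTo (T : ℕ) : Set GroupClass :=
  {c | c ∈ groupsUpTo T ∧
    ∃ (G : Type) (_ : Group G), c = groupClass G ∧ Finite G ∧ ∀ a b : G, a * b = b * a}

end SimplicialComplexity

/-! The fundamental group of a connected simplicial complex is its edge group: one generator for
each ordered edge, one family of relators for each simplex, and the edges of a spanning tree killed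
(`edgeGroupEquiv`). Loops come from edge paths because a path can be cut into pieces lying in open
stars of vertices. No further relations arise, because the edge group is the fibre of a covering
whose monodromy is left translation.

Upper bound. Edges lying in no triangle and not in the tree satisfy no relation, so they split off a
free factor (`splitEquiv`). In free index zero there are none, and the group depends only on the
family of triangles and a spanning forest of its edges (`IsTwoComplexFor.nonempty_mulEquiv`). At
most `T` triangles use at most `3T` vertices, so the group is encoded by `T` entries, each a
3-subset of `3T` labels or a blank. There are `C(3T,3) + 1 ≤ T^6` choices per entry, and `T^(6T) =
2^(6T log₂ T)`.

Lower bound. The group `ℤ/m` is realized with at most `3 + 14 log₂ m` triangles by a telescope that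
reads off the binary digits of `m` as in Horner's scheme (`exists_horner_eq`). A stage turns a loop
of class `c` into one of class `2c` (9 triangles) or `2c + 1` (12 triangles); a last triangle kills
the final loop. Finite groups have no nontrivial free group as a free factor, so the `ℤ/m` with `1 ≤
m ≤ 2^((T-3)/14)` are distinct members of `𝒜_κ(T)`. -/

open unitInterval

namespace SimplicialComplexity

/-! ### Straight-line homotopies in the realization -/

section Realization

variable {ι : Type} [Fintype ι] {K : AbstractSimplicialComplex ι}

/-- Two points of the realization lie in a common closed simplex. -/
def Close (x y : realization K) : Prop :=
  ∃ s ∈ K.faces, (∀ v, v ∉ s → x.1 v = 0) ∧ ∀ v, v ∉ s → y.1 v = 0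

lemma Close.symm {x y : realization K} (h : Close x y) : Close y x := by
  obtain ⟨s, hs, h1, h2⟩ := h
  exact ⟨s, hs, h2, h1⟩

lemma close_self (x : realization K) : Close x x := by
  obtain ⟨s, hs, h⟩ := x.2.2
  exact ⟨s, hs, h, h⟩

/-- The point dividing the segment between two points of a common simplex in the ratio
`t : 1 - t`. -/
def mix (x y : realization K) (h : Close x y) (t : I) : realization K :=
  ⟨fun v => (1 - t.1) * x.1 v + t.1 * y.1 v, by
    refine ⟨⟨fun v => ?_, ?_⟩, ?_⟩
    · have h1 := x.2.1.1 v
      have h2 := y.2.1.1 v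
      have h3 := t.2.1
      have h4 : 0 ≤ 1 - t.1 := sub_nonneg.2 t.2.2
      positivity
    · rw [Finset.sum_add_distrib, ← Finset.mul_sum, ← Finset.mul_sum, x.2.1.2, y.2.1.2]
      ring
    · obtain ⟨s, hs, h1, h2⟩ := h
      exact ⟨s, hs, fun v hv => by simp [h1 v hv, h2 v hv]⟩⟩

/-- Paths which at each time lie in a common simplex are homotopic. -/
lemma homotopic_of_close {x y : realization K} (p q : Path x y) (h : ∀ t, Close (p t) (q t)) :
    p.Homotopic q := by
  -- The homotopy is polynomial in barycentric coordinates, so it is continuous although the common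
  -- simplex is not chosen continuously.
  refine ⟨{ toFun := fun st => mix (p st.2) (q st.2) (h st.2) st.1
            continuous_toFun := ?_, map_zero_left := ?_, map_one_left := ?_, prop' := ?_ }⟩
  · refine Continuous.subtype_mk (continuous_pi fun v => ?_) _
    have h1 : Continuous fun st : I × I => (p st.2).1 v :=
      (continuous_apply v).comp (continuous_subtype_val.comp (p.continuous.comp continuous_snd))
    have h2 : Continuous fun st : I × I => (q st.2).1 v :=
      (continuous_apply v).comp (continuous_subtype_val.comp (q.continuous.comp continuous_snd))
    have h3 : Continuous fun st : I × I => (st.1 : ℝ) :=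
      continuous_subtype_val.comp continuous_fst
    exact ((continuous_const.sub h3).mul h1).add (h3.mul h2)
  · intro t
    apply Subtype.ext
    funext v
    simp [mix]
  · intro t
    apply Subtype.ext
    funext v
    simp [mix]
  · intro t u hu
    apply Subtype.ext
    funext v
    rcases hu with rfl | rfl <;> simp [mix] <;> ring

/-- The straight path between two points of a common simplex. -/
def segPath (x y : realization K) (h : Close x y) : Path x y where
  toFun := mix x y h
  continuous_toFun := by
    refine Continuous.subtype_mk (continuous_pi fun v => ?_) _
    have h3 : Continuous fun t : I => (t : ℝ) := continuous_subtype_val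
    exact ((continuous_const.sub h3).mul continuous_const).add (h3.mul continuous_const)
  source' := by apply Subtype.ext; funext v; simp [mix]
  target' := by apply Subtype.ext; funext v; simp [mix]

/-- The homotopy class of the straight path between two points of a common simplex. -/
def seg (x y : realization K) (h : Close x y) : Path.Homotopic.Quotient x y :=
  Path.Homotopic.Quotient.mk (segPath x y h)

lemma mix_eq_zero {x y : realization K} (h : Close x y) {v : ι} (hx : x.1 v = 0) (hy : y.1 v = 0)
    (t : I) : (mix x y h t).1 v = 0 := by
  simp [mix, hx, hy]

lemma mix_pos_left {x y : realization K} (h : Close x y) {v : ι} (hx : 0 < x.1 v)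
    (t : I) (ht : t.1 < 1) : 0 < (mix x y h t).1 v := by
  have h2 := y.2.1.1 v
  have h3 := t.2.1
  have h4 : 0 < 1 - t.1 := sub_pos.2 ht
  simp only [mix]
  positivity

lemma mix_pos {x y : realization K} (h : Close x y) {v : ι} (hx : 0 < x.1 v) (hy : 0 < y.1 v)
    (t : I) : 0 < (mix x y h t).1 v := by
  rcases t.2.2.lt_or_eq with h1 | h1
  · exact mix_pos_left h hx t h1
  · simp [mix, h1, hy]

lemma trans_forall {X : Type*} [TopologicalSpace X] {x y z : X} {p : Path x y} {q : Path y z}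
    {P : X → Prop} (hp : ∀ t, P (p t)) (hq : ∀ t, P (q t)) (t : I) : P (p.trans q t) := by
  rw [Path.trans_apply]
  split_ifs
  exacts [hp _, hq _]

lemma trans_forall₂ {X : Type*} [TopologicalSpace X] {x y z x' y' z' : X}
    {p : Path x y} {q : Path y z} {p' : Path x' y'} {q' : Path y' z'}
    {P : X → X → Prop} (hp : ∀ t, P (p t) (p' t)) (hq : ∀ t, P (q t) (q' t)) (t : I) :
    P (p.trans q t) (p'.trans q' t) := by
  simp only [Path.trans_apply]
  split_ifs
  exacts [hp _, hq _]

/-- Straight paths in a common simplex compose. -/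
lemma seg_trans {x y z : realization K} (s : Finset ι) (hs : s ∈ K.faces)
    (hx : ∀ v, v ∉ s → x.1 v = 0) (hy : ∀ v, v ∉ s → y.1 v = 0) (hz : ∀ v, v ∉ s → z.1 v = 0)
    (hxy : Close x y) (hyz : Close y z) (hxz : Close x z) :
    (seg x y hxy).trans (seg y z hyz) = seg x z hxz := by
  unfold seg
  rw [← Path.Homotopic.Quotient.mk_trans, Path.Homotopic.Quotient.eq]
  refine homotopic_of_close _ _ fun t => ⟨s, hs, ?_, fun v hv => ?_⟩
  · exact trans_forall (P := fun w : realization K => ∀ v, v ∉ s → w.1 v = 0)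
      (fun t v hv => mix_eq_zero hxy (hx v hv) (hy v hv) t)
      (fun t v hv => mix_eq_zero hyz (hy v hv) (hz v hv) t) t
  · exact mix_eq_zero hxz (hx v hv) (hz v hv) t

lemma seg_self (x : realization K) (h : Close x x) : seg x x h = Path.Homotopic.Quotient.refl x := by
  unfold seg
  rw [← Path.Homotopic.Quotient.mk_refl, Path.Homotopic.Quotient.eq]
  refine homotopic_of_close _ _ fun t => ?_
  obtain ⟨s, hs, h1, -⟩ := id h
  exact ⟨s, hs, fun v hv => mix_eq_zero h (h1 v hv) (h1 v hv) t, h1⟩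

open Classical in
variable (K) in
/-- The vertices of the realization. -/
noncomputable def vert (v : ι) : realization K :=
  ⟨Pi.single v 1, single_mem_stdSimplex ℝ v, {v}, K.singleton_mem v, fun w hw => by
    simp at hw; simp [hw]⟩

lemma vert_self (v : ι) : (vert K v).1 v = 1 := by simp [vert]

lemma vert_of_ne {v w : ι} (h : w ≠ v) : (vert K v).1 w = 0 := by simp [vert, h]

lemma exists_pos (x : realization K) : ∃ v, 0 < x.1 v := by
  by_contra! h
  have h2 := x.2.1.2
  rw [Finset.sum_eq_zero fun v _ => le_antisymm (h v) (x.2.1.1 v)] at h2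
  exact zero_ne_one h2

lemma mem_of_pos {x : realization K} {s : Finset ι} (h : ∀ v, v ∉ s → x.1 v = 0) {v : ι}
    (hv : 0 < x.1 v) : v ∈ s := by
  by_contra h1
  exact hv.ne' (h v h1)

lemma vert_eq_zero {s : Finset ι} {a : ι} (ha : a ∈ s) (v : ι) (hv : v ∉ s) :
    (vert K a).1 v = 0 := vert_of_ne fun h => hv (h ▸ ha)

lemma close_vert {x : realization K} {v : ι} (h : 0 < x.1 v) : Close x (vert K v) := by
  obtain ⟨s, hs, h1⟩ := x.2.2
  exact ⟨s, hs, h1, vert_eq_zero (mem_of_pos h1 h)⟩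

lemma close_vert_vert {s : Finset ι} (hs : s ∈ K.faces) {a b : ι} (ha : a ∈ s) (hb : b ∈ s) :
    Close (vert K a) (vert K b) :=
  ⟨s, hs, vert_eq_zero ha, vert_eq_zero hb⟩

/-- A path in the open star of a vertex is homotopic to the one through that vertex. -/
lemma mk_eq_of_star {x y : realization K} (p : Path x y) (v : ι) (h : ∀ t, 0 < (p t).1 v)
    (hx : Close x (vert K v)) (hy : Close (vert K v) y) :
    Path.Homotopic.Quotient.mk p = (seg x _ hx).trans (seg _ y hy) := by
  -- Constant pieces synchronize the two paths: the first waits at `x` while the second runs to `v`,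
  -- then the second waits at `v` during `p`, and so on. At each time both lie in a common simplex.
  have h1 : ((Path.refl x).trans (p.trans (Path.refl y))).Homotopic
      ((segPath x _ hx).trans ((Path.refl (vert K v)).trans (segPath _ y hy))) := by
    refine homotopic_of_close _ _ (trans_forall₂ (fun t => ?_) (trans_forall₂ (fun t => ?_)
      fun t => ?_))
    · obtain ⟨s, hs, h1, h2⟩ := id hx
      exact ⟨s, hs, h1, fun v hv => mix_eq_zero hx (h1 v hv) (h2 v hv) t⟩
    · exact close_vert (h t)
    · obtain ⟨s, hs, h1, h2⟩ := id hy
      exact ⟨s, hs, h2, fun v hv => mix_eq_zero hy (h1 v hv) (h2 v hv) t⟩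
  rw [← Path.Homotopic.Quotient.eq] at h1
  simp only [Path.Homotopic.Quotient.mk_trans, Path.Homotopic.Quotient.mk_refl,
    Path.Homotopic.Quotient.refl_trans, Path.Homotopic.Quotient.trans_refl] at h1
  exact h1

end Realization

/-! ### Monodromy of bundles with discrete fibre -/

section Monodromy

variable {B J F : Type} [TopologicalSpace B] [TopologicalSpace F] [DiscreteTopology F]
  (Z : FiberBundleCore J B F)

lemma isCoveringMap_proj : IsCoveringMap Z.proj := FiberBundle.isCoveringMap

/-- Monodromy along a path contained in one chart. -/
lemma monodromy_of_mem_baseSet (i : J) {x y : B} (p : Path x y) (h : ∀ t, p t ∈ Z.baseSet i)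
    (f : F) :
    (isCoveringMap_proj Z).monodromy (Path.Homotopic.Quotient.mk p) ⟨⟨x, f⟩, rfl⟩ =
      ⟨⟨y, Z.coordChange i (Z.indexAt y) y (Z.coordChange (Z.indexAt x) i x f)⟩, rfl⟩ := by
  set c := Z.coordChange (Z.indexAt x) i x f with hc
  -- The section constant in chart `i`; composed with `p` it is the lift that computes the
  -- monodromy.
  let L : B → Z.TotalSpace := fun b => ⟨b, Z.coordChange i (Z.indexAt b) b c⟩
  have hx : x ∈ Z.baseSet i := p.source ▸ h 0
  have hL : L x = ⟨x, f⟩ := by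
    change (⟨x, _⟩ : Z.TotalSpace) = ⟨x, f⟩
    congr 1
    rw [hc, Z.coordChange_comp, Z.coordChange_self]
    · exact Z.mem_baseSet_at x
    · exact ⟨⟨Z.mem_baseSet_at x, hx⟩, Z.mem_baseSet_at x⟩
  have hcont : Continuous fun t => L (p t) := by
    have h1 := (Z.localTriv i).continuousOn_invFun
    have h2 : Continuous fun t : I => (p t, c) := p.continuous.prodMk continuous_const
    exact h1.comp_continuous h2 fun t => ⟨h t, trivial⟩
  let Γ : Path (⟨x, f⟩ : Z.TotalSpace) (L y) :=
    { toFun := fun t => L (p t)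
      continuous_toFun := hcont
      source' := by simp [hL]
      target' := by simp }
  refine (isCoveringMap_proj Z).monodromy_eq_of_map_eq (Path.Homotopic.Quotient.mk Γ) ?_
  rfl

end Monodromy

/-! ### The flat bundle of an edge cocycle -/

section Bundle

variable {ι : Type} [Fintype ι] (K : AbstractSimplicialComplex ι)
  {E : Type} [Group E] [TopologicalSpace E] [DiscreteTopology E] (g : ι → ι → E)
  (hg : ∀ s ∈ K.faces, ∀ a ∈ s, ∀ b ∈ s, ∀ c ∈ s, g a b * g b c = g a c)

/-- The flat bundle over the realization defined by a cocycle on the edges, trivialized over the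
open stars of the vertices. -/
noncomputable def flatBundle : FiberBundleCore ι (realization K) E where
  baseSet v := {x | 0 < x.1 v}
  isOpen_baseSet v :=
    isOpen_lt continuous_const ((continuous_apply v).comp continuous_subtype_val)
  indexAt x := (exists_pos x).choose
  mem_baseSet_at x := (exists_pos x).choose_spec
  coordChange i j _ f := g j i * f
  coordChange_self i x hx f := by
    have h := hg {i} (K.singleton_mem i) i (by simp) i (by simp) i (by simp)
    rw [mul_eq_left] at h
    rw [h, one_mul]
  continuousOn_coordChange i j := by
    have h : Continuous fun f : E => g j i * f := continuous_of_discreteTopology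
    exact (h.comp continuous_snd).continuousOn
  coordChange_comp i j k x hx f := by
    obtain ⟨s, hs, h⟩ := x.2.2
    rw [← mul_assoc, hg s hs k (mem_of_pos h hx.2) j (mem_of_pos h hx.1.2) i
      (mem_of_pos h hx.1.1)]

lemma indexAt_vert (v : ι) : (flatBundle K g hg).indexAt (vert K v) = v := by
  by_contra h
  have h1 := (flatBundle K g hg).mem_baseSet_at (vert K v)
  change 0 < (vert K v).1 _ at h1
  rw [vert_of_ne h] at h1
  exact h1.false

/-- Monodromy of the flat bundle along an edge. -/
lemma monodromy_seg {a b : ι} (s : Finset ι) (hs : s ∈ K.faces) (ha : a ∈ s) (hb : b ∈ s)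
    (h : Close (vert K a) (vert K b)) (f : E) :
    (isCoveringMap_proj (flatBundle K g hg)).monodromy (seg (vert K a) (vert K b) h)
      ⟨⟨vert K a, f⟩, rfl⟩ = ⟨⟨vert K b, g b a * f⟩, rfl⟩ := by
  -- The midpoint lies in both open stars, so each half of the edge stays in one chart. The unknown
  -- chart index at the midpoint is a vertex of `s` and cancels by the cocycle identity.
  let t : I := ⟨1 / 2, by norm_num, by norm_num⟩
  let m : realization K := mix _ _ h t
  have hma : 0 < m.1 a := mix_pos_left h (by rw [vert_self]; norm_num) t (by norm_num [t])
  have hmb : 0 < m.1 b := by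
    have h1 := (vert K a).2.1.1 b
    simp only [m, mix, vert_self, t]
    linarith
  have hms : ∀ v, v ∉ s → m.1 v = 0 := fun v hv =>
    mix_eq_zero h (vert_eq_zero ha v hv) (vert_eq_zero hb v hv) t
  have ham : Close (vert K a) m := ⟨s, hs, vert_eq_zero ha, hms⟩
  have hmb' : Close m (vert K b) := ⟨s, hs, hms, vert_eq_zero hb⟩
  rw [← seg_trans s hs (vert_eq_zero ha) hms (vert_eq_zero hb) ham hmb' h,
    IsCoveringMap.monodromy_trans_apply]
  unfold seg
  rw [monodromy_of_mem_baseSet _ a, monodromy_of_mem_baseSet _ b]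
  · rw [indexAt_vert, indexAt_vert]
    simp only [flatBundle]
    have hi := mem_of_pos hms (exists_pos m).choose_spec
    simp only [← mul_assoc]
    congr 3
    rw [mul_assoc, hg s hs b hb b hb _ hi, hg s hs _ hi a ha a ha, hg s hs b hb _ hi a ha]
  · exact fun t => mix_pos hmb' hmb (by rw [vert_self]; norm_num) t
  · exact fun t => mix_pos ham (by rw [vert_self]; norm_num) hma t

end Bundle

/-! ### The edge group: presentation and universal property -/

section EdgeGroup

variable {V : Type} (S : Set (Finset V)) (T : SimpleGraph V)

/-- The relators of the edge group: edges of `T` and pairs of vertices not in a common simplex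
are trivial, and the edges of a simplex compose. -/
def edgeRels : Set (FreeGroup (V × V)) :=
  {r | ∃ a b, (T.Adj a b ∨ ∀ s ∈ S, a ∈ s → b ∉ s) ∧ r = FreeGroup.of (a, b)} ∪
  {r | ∃ s ∈ S, ∃ a ∈ s, ∃ b ∈ s, ∃ c ∈ s,
    r = FreeGroup.of (a, b) * FreeGroup.of (b, c) * (FreeGroup.of (a, c))⁻¹}

/-- The edge group of a family `S` of simplices, relative to a forest `T`. -/
def EdgeGroup : Type := PresentedGroup (edgeRels S T)

instance : Group (EdgeGroup S T) := inferInstanceAs (Group (PresentedGroup (edgeRels S T)))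

/-- The generator of the edge group given by an ordered pair of vertices. -/
def edge (a b : V) : EdgeGroup S T := PresentedGroup.of (a, b)

variable {S T}

lemma edge_mul {s : Finset V} (hs : s ∈ S) {a b c : V} (ha : a ∈ s) (hb : b ∈ s) (hc : c ∈ s) :
    edge S T a b * edge S T b c = edge S T a c := by
  rw [← mul_inv_eq_one]
  exact PresentedGroup.one_of_mem (Or.inr ⟨s, hs, a, ha, b, hb, c, hc, rfl⟩)

lemma edge_of_adj {a b : V} (h : T.Adj a b) : edge S T a b = 1 :=
  PresentedGroup.one_of_mem (Or.inl ⟨a, b, Or.inl h, rfl⟩)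

lemma edge_of_not {a b : V} (h : ∀ s ∈ S, a ∈ s → b ∉ s) : edge S T a b = 1 :=
  PresentedGroup.one_of_mem (Or.inl ⟨a, b, Or.inr h, rfl⟩)

lemma edge_self (a : V) : edge S T a a = 1 := by
  by_cases h : ∃ s ∈ S, a ∈ s
  · obtain ⟨s, hs, ha⟩ := h
    exact mul_eq_left.1 (edge_mul hs ha ha ha)
  · push Not at h
    exact edge_of_not fun s hs ha => absurd ha (h s hs)

lemma edge_symm (a b : V) : edge S T b a = (edge S T a b)⁻¹ := by
  by_cases h : ∃ s ∈ S, a ∈ s ∧ b ∈ s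
  · obtain ⟨s, hs, ha, hb⟩ := h
    rw [eq_inv_iff_mul_eq_one, edge_mul hs hb ha hb, edge_self]
  · push Not at h
    rw [edge_of_not h, edge_of_not fun s hs hb ha => h s hs ha hb, inv_one]

/-- Homomorphisms out of the edge group. -/
def edgeLift {G : Type*} [Group G] (f : V → V → G) (h1 : ∀ a b, T.Adj a b → f a b = 1)
    (h2 : ∀ a b, (∀ s ∈ S, a ∈ s → b ∉ s) → f a b = 1)
    (h3 : ∀ s ∈ S, ∀ a ∈ s, ∀ b ∈ s, ∀ c ∈ s, f a b * f b c = f a c) : EdgeGroup S T →* G :=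
  PresentedGroup.toGroup (f := fun p : V × V => f p.1 p.2) (by
    rintro r (⟨a, b, h | h, rfl⟩ | ⟨s, hs, a, ha, b, hb, c, hc, rfl⟩)
    · simpa using h1 a b h
    · simpa using h2 a b h
    · simp [h3 s hs a ha b hb c hc])

@[simp] lemma edgeLift_edge {G : Type*} [Group G] (f : V → V → G) (h1 h2 h3) (a b : V) :
    edgeLift (S := S) (T := T) f h1 h2 h3 (edge S T a b) = f a b :=
  PresentedGroup.toGroup.of _

lemma edgeGroup_hom_ext {G : Type*} [Group G] {f g : EdgeGroup S T →* G}
    (h : ∀ a b, f (edge S T a b) = g (edge S T a b)) : f = g :=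
  PresentedGroup.ext fun x => h x.1 x.2

end EdgeGroup

/-! ### Edge paths of walks -/

section Walks

variable {ι : Type} [Fintype ι] {K : AbstractSimplicialComplex ι} {T : SimpleGraph ι}
  (hT : ∀ a b, T.Adj a b → ∃ s ∈ K.faces, a ∈ s ∧ b ∈ s)

lemma close_of_exists {a b : ι} (h : ∃ s ∈ K.faces, a ∈ s ∧ b ∈ s) :
    Close (vert K a) (vert K b) := by
  obtain ⟨s, hs, ha, hb⟩ := h
  exact close_vert_vert hs ha hb

/-- The homotopy class of the edge path of a walk. -/
noncomputable def walkClass : {a b : ι} → T.Walk a b →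
    Path.Homotopic.Quotient (vert K a) (vert K b)
  | a, _, .nil => Path.Homotopic.Quotient.refl (vert K a)
  | _, _, .cons h p => (seg _ _ (close_of_exists (hT _ _ h))).trans (walkClass p)

lemma walkClass_concat {a b c : ι} (p : T.Walk a b) (h : T.Adj b c) :
    walkClass hT (p.concat h) =
      (walkClass hT p).trans (seg _ _ (close_of_exists (hT _ _ h))) := by
  induction p with
  | nil => simp [walkClass, SimpleGraph.Walk.concat, Path.Homotopic.Quotient.refl_trans,
      Path.Homotopic.Quotient.trans_refl]
  | cons h' p ih =>
    rw [SimpleGraph.Walk.concat_cons]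
    simp only [walkClass]
    rw [ih, Path.Homotopic.Quotient.trans_assoc]

lemma seg_symm {x y : realization K} (h : Close x y) :
    (seg x y h).trans (seg y x h.symm) = Path.Homotopic.Quotient.refl x := by
  obtain ⟨s, hs, h1, h2⟩ := id h
  rw [seg_trans s hs h1 h2 h1 h h.symm (close_self x), seg_self]

lemma pathConnectedSpace_of_walks (v₀ : ι) (w : ∀ a, T.Walk v₀ a)
    (hT : ∀ a b, T.Adj a b → ∃ s ∈ K.faces, a ∈ s ∧ b ∈ s) :
    PathConnectedSpace (realization K) := by
  have h : ∀ x : realization K, Joined (vert K v₀) x := fun x => by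
    obtain ⟨a, ha⟩ := exists_pos x
    exact Joined.trans ⟨Quotient.out (walkClass hT (w a))⟩ ⟨segPath _ _ (close_vert ha).symm⟩
  exact ⟨⟨vert K v₀⟩, fun x y => (h x).symm.trans (h y)⟩

end Walks

/-! ### The edge group is the fundamental group -/

section Main

variable {ι : Type} [Fintype ι] (K : AbstractSimplicialComplex ι) (T : SimpleGraph ι)
  (hT : ∀ a b, T.Adj a b → ∃ s ∈ K.faces, a ∈ s ∧ b ∈ s) (v₀ : ι) (w : ∀ a, T.Walk v₀ a)

lemma Quotient.symm_trans_cancel {X : Type*} [TopologicalSpace X] {x y z : X}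
    (p : Path.Homotopic.Quotient x y) (q : Path.Homotopic.Quotient y z) :
    p.symm.trans (p.trans q) = q := by
  rw [← Path.Homotopic.Quotient.trans_assoc, Path.Homotopic.Quotient.symm_trans,
    Path.Homotopic.Quotient.refl_trans]

lemma seg_cancel {x y z : realization K} (h : Close x y) (h' : Close y x)
    (q : Path.Homotopic.Quotient x z) : (seg x y h).trans ((seg y x h').trans q) = q := by
  rw [← Path.Homotopic.Quotient.trans_assoc, seg_symm, Path.Homotopic.Quotient.refl_trans]

/-- Close up a path between vertices to a loop at the base vertex. -/
noncomputable def closeUp {a b : ι} (p : Path.Homotopic.Quotient (vert K a) (vert K b)) :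
    FundamentalGroup (realization K) (vert K v₀) :=
  FundamentalGroup.fromPath (((walkClass hT (w a)).trans p).trans (walkClass hT (w b)).symm)

variable {K T v₀}

/-- Multiplication in `FundamentalGroup` reverses concatenation; this is why `edgeLoop a b` runs
from `b` to `a`. -/
lemma closeUp_trans {a b c : ι} (p : Path.Homotopic.Quotient (vert K a) (vert K b))
    (q : Path.Homotopic.Quotient (vert K b) (vert K c)) :
    closeUp K T hT v₀ w (p.trans q) = closeUp K T hT v₀ w q * closeUp K T hT v₀ w p := by
  rw [FundamentalGroup.mul_def]
  unfold closeUp FundamentalGroup.fromPath FundamentalGroup.fromArrow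
  simp only [Path.Homotopic.Quotient.trans_assoc, Quotient.symm_trans_cancel]

open Classical in
/-- The loop at the base vertex which runs along the edge from `b` to `a`. -/
noncomputable def edgeLoop (a b : ι) : FundamentalGroup (realization K) (vert K v₀) :=
  if h : ∃ s ∈ K.faces, a ∈ s ∧ b ∈ s then
    closeUp K T hT v₀ w (seg _ _ (close_of_exists h).symm)
  else 1

lemma edgeLoop_of_mem {s : Finset ι} (hs : s ∈ K.faces) {a b : ι} (ha : a ∈ s) (hb : b ∈ s) :
    edgeLoop hT w a b = closeUp K T hT v₀ w (seg _ _ (close_vert_vert hs hb ha)) :=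
  dif_pos ⟨s, hs, ha, hb⟩

lemma edgeLoop_of_not {a b : ι} (h : ∀ s ∈ K.faces, a ∈ s → b ∉ s) :
    edgeLoop (v₀ := v₀) hT w a b = 1 :=
  dif_neg fun ⟨s, hs, ha, hb⟩ => h s hs ha hb

variable (hw : ∀ a b (h : T.Adj a b), w b = (w a).concat h ∨ w a = (w b).concat h.symm)

include hw in
-- Of the walks to the two ends of a tree edge, one extends the other by that edge, so the loop
-- backtracks completely.
lemma edgeLoop_of_adj {a b : ι} (h : T.Adj a b) :
    edgeLoop (v₀ := v₀) hT w a b = 1 := by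
  obtain ⟨s, hs, ha, hb⟩ := hT a b h
  rw [edgeLoop_of_mem hT w hs ha hb, FundamentalGroup.one_def]
  unfold closeUp
  rcases hw a b h with h1 | h1
  · rw [h1, walkClass_concat, Path.Homotopic.Quotient.trans_assoc (walkClass hT (w a)), seg_symm,
      Path.Homotopic.Quotient.trans_refl, Path.Homotopic.Quotient.trans_symm]
  · rw [h1, walkClass_concat, Path.Homotopic.Quotient.trans_symm]

/-- The homomorphism from the edge group to the fundamental group. -/
noncomputable def edgeToLoop (hw : ∀ a b (h : T.Adj a b),
    w b = (w a).concat h ∨ w a = (w b).concat h.symm) :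
    EdgeGroup K.faces T →* FundamentalGroup (realization K) (vert K v₀) :=
  edgeLift (edgeLoop hT w) (fun _ _ => edgeLoop_of_adj hT w hw)
    (fun _ _ => edgeLoop_of_not hT w)
    (fun s hs a ha b hb c hc => by
      rw [edgeLoop_of_mem hT w hs ha hb, edgeLoop_of_mem hT w hs hb hc,
        edgeLoop_of_mem hT w hs ha hc, ← closeUp_trans,
        seg_trans s hs (vert_eq_zero hc) (vert_eq_zero hb) (vert_eq_zero ha)])

@[simp] lemma edgeToLoop_edge (a b : ι) :
    edgeToLoop hT w hw (edge _ _ a b) = edgeLoop (v₀ := v₀) hT w a b :=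
  edgeLift_edge ..

lemma closeUp_seg_mem_range {a b : ι} (h : ∃ s ∈ K.faces, a ∈ s ∧ b ∈ s)
    (hc : Close (vert K a) (vert K b)) :
    closeUp K T hT v₀ w (seg _ _ hc) ∈ (edgeToLoop hT w hw).range := by
  obtain ⟨s, hs, ha, hb⟩ := h
  refine ⟨edge _ _ b a, ?_⟩
  rw [edgeToLoop_edge, edgeLoop_of_mem hT w hs hb ha]

/-- The loops obtained by closing up a path between points of the realization through vertices
of their carriers come from the edge group. -/
def Good {x y : realization K} (p : Path.Homotopic.Quotient x y) : Prop :=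
  ∀ a b (ha : 0 < x.1 a) (hb : 0 < y.1 b),
    closeUp K T hT v₀ w ((seg _ _ (close_vert ha).symm).trans (p.trans (seg _ _ (close_vert hb)))) ∈
      (edgeToLoop hT w hw).range

/-- Any vertex of the carrier of `y` serves as a cut: the inserted segments to it and back cancel.
`Good` quantifies over all such vertices so that the two choices at `y` agree. -/
lemma Good.trans {x y z : realization K} {p : Path.Homotopic.Quotient x y}
    {q : Path.Homotopic.Quotient y z} (hp : Good hT w hw p) (hq : Good hT w hw q) :
    Good hT w hw (p.trans q) := by
  intro a b ha hb
  obtain ⟨c, hc⟩ := exists_pos y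
  have h := mul_mem (hq c b hc hb) (hp a c ha hc)
  rw [← closeUp_trans] at h
  simpa only [Path.Homotopic.Quotient.trans_assoc, seg_cancel] using h

lemma good_of_star {x y : realization K} (p : Path x y) (v : ι) (h : ∀ t, 0 < (p t).1 v) :
    Good hT w hw (Path.Homotopic.Quotient.mk p) := by
  intro a b ha hb
  have hx : 0 < x.1 v := by simpa using h 0
  have hy : 0 < y.1 v := by simpa using h 1
  obtain ⟨s, hs, h1⟩ := x.2.2
  obtain ⟨s', hs', h2⟩ := y.2.2
  have e1 := mem_of_pos h1 ha
  have e2 := mem_of_pos h1 hx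
  have e3 := mem_of_pos h2 hy
  have e4 := mem_of_pos h2 hb
  rw [mk_eq_of_star p v h (close_vert hx) (close_vert hy).symm]
  have h3 := mul_mem (closeUp_seg_mem_range hT w hw ⟨s', hs', e3, e4⟩ (close_vert_vert hs' e3 e4))
    (closeUp_seg_mem_range hT w hw ⟨s, hs, e1, e2⟩ (close_vert_vert hs e1 e2))
  rw [← closeUp_trans, ← seg_trans s hs (vert_eq_zero e1) h1 (vert_eq_zero e2)
      (close_vert ha).symm (close_vert hx), ← seg_trans s' hs' (vert_eq_zero e3) h2
      (vert_eq_zero e4) (close_vert hy).symm (close_vert hb)] at h3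
  simpa only [Path.Homotopic.Quotient.trans_assoc] using h3

/-- The open stars cover the realization, so compactness of the interval yields a subdivision with
each piece in one star. -/
lemma good_mk {x y : realization K} (p : Path x y) :
    Good hT w hw (Path.Homotopic.Quotient.mk p) := by
  obtain ⟨t, ht0, htm, ⟨n, hn⟩, ht⟩ := exists_monotone_Icc_subset_open_cover_unitInterval
    (c := fun v : ι => {t : I | 0 < (p t).1 v})
    (fun v => isOpen_lt continuous_const
      ((continuous_apply v).comp (continuous_subtype_val.comp p.continuous)))
    (fun t _ => Set.mem_iUnion.2 (exists_pos (p t)))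
  have h : ∀ m, Good hT w hw (Path.Homotopic.Quotient.mk (p.subpath (t 0) (t m))) := by
    intro m
    induction m with
    | zero =>
      obtain ⟨v, hv⟩ := exists_pos (p (t 0))
      exact good_of_star hT w hw _ v (by simpa using hv)
    | succ m ih =>
      have h1 : Path.Homotopic.Quotient.mk (p.subpath (t 0) (t (m + 1))) =
          (Path.Homotopic.Quotient.mk (p.subpath (t 0) (t m))).trans
            (Path.Homotopic.Quotient.mk (p.subpath (t m) (t (m + 1)))) := by
        rw [← Path.Homotopic.Quotient.mk_trans, Path.Homotopic.Quotient.eq]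
        exact ⟨(Path.Homotopy.subpathTransSubpath p _ _ _).symm⟩
      rw [h1]
      refine ih.trans hT w hw ?_
      obtain ⟨v, hv⟩ := ht m
      refine good_of_star hT w hw _ v fun u => ?_
      have h2 : p.subpath (t m) (t (m + 1)) u ∈ Set.range (p.subpath (t m) (t (m + 1))) := ⟨u, rfl⟩
      rw [Path.range_subpath_of_le p _ _ (htm (Nat.le_succ m))] at h2
      obtain ⟨u', hu', h3⟩ := h2
      rw [← h3]
      exact hv hu'
  have h4 := h n
  rw [ht0, hn n le_rfl, Path.subpath_zero_one] at h4
  have h5 : ∀ {x' y' : realization K} (hx : x' = x) (hy : y' = y),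
      Good hT w hw (Path.Homotopic.Quotient.mk (p.cast hx hy)) →
      Good hT w hw (Path.Homotopic.Quotient.mk p) := by
    rintro x' y' rfl rfl h
    exact h
  exact h5 _ _ h4

lemma edgeToLoop_surjective : Function.Surjective (edgeToLoop (v₀ := v₀) hT w hw) := by
  intro p
  have h1 : (vert K v₀).1 v₀ = 1 := vert_self v₀
  have h2 : 0 < (vert K v₀).1 v₀ := by rw [h1]; exact one_pos
  -- Conjugation by the walk from `v₀` to itself undoes `closeUp`, so that walk need not be known to
  -- be trivial.
  obtain ⟨q, hq⟩ := Path.Homotopic.Quotient.mk_surjective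
    (((walkClass hT (w v₀)).symm.trans p).trans (walkClass hT (w v₀)))
  obtain ⟨e, he⟩ := good_mk hT w hw q v₀ v₀ h2 h2
  refine ⟨e, he.trans ?_⟩
  rw [seg_self, hq, Path.Homotopic.Quotient.refl_trans,
    Path.Homotopic.Quotient.trans_refl]
  unfold closeUp
  simp only [Path.Homotopic.Quotient.trans_assoc, Path.Homotopic.Quotient.trans_symm,
    Path.Homotopic.Quotient.trans_refl]
  rw [← Path.Homotopic.Quotient.trans_assoc, Path.Homotopic.Quotient.trans_symm,
    Path.Homotopic.Quotient.refl_trans]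

/-- For the flat bundle with fibre the edge group, monodromy after `edgeToLoop` is the left regular
representation, which is faithful. -/
lemma edgeToLoop_injective : Function.Injective (edgeToLoop (v₀ := v₀) hT w hw) := by
  let _ : TopologicalSpace (EdgeGroup K.faces T) := ⊥
  have _ : DiscreteTopology (EdgeGroup K.faces T) := ⟨rfl⟩
  have hg : ∀ s ∈ K.faces, ∀ a ∈ s, ∀ b ∈ s, ∀ c ∈ s,
      edge K.faces T a b * edge K.faces T b c = edge K.faces T a c :=
    fun s hs a ha b hb c hc => edge_mul hs ha hb hc
  let Z := flatBundle K (edge K.faces T) hg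
  have cov := isCoveringMap_proj Z
  have hwalk : ∀ {a b : ι} (p : T.Walk a b) (f : EdgeGroup K.faces T),
      cov.monodromy (walkClass hT p) ⟨⟨vert K a, f⟩, rfl⟩ = ⟨⟨vert K b, f⟩, rfl⟩ := by
    intro a b p
    induction p with
    | nil => intro f; simp only [walkClass]; rw [IsCoveringMap.monodromy_refl]; rfl
    | cons h p ih =>
      intro f
      obtain ⟨s, hs, ha, hb⟩ := hT _ _ h
      simp only [walkClass]
      rw [IsCoveringMap.monodromy_trans_apply, monodromy_seg K _ hg s hs ha hb,
        edge_of_adj h.symm, one_mul, ih]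
  have hwalk' : ∀ {a b : ι} (p : T.Walk a b) (f : EdgeGroup K.faces T),
      cov.monodromy (walkClass hT p).symm ⟨⟨vert K b, f⟩, rfl⟩ = ⟨⟨vert K a, f⟩, rfl⟩ := by
    intro a b p f
    rw [← hwalk p f, ← IsCoveringMap.monodromy_trans_apply, Path.Homotopic.Quotient.trans_symm,
      IsCoveringMap.monodromy_refl]
    rfl
  let F : EdgeGroup K.faces T ≃ Z.proj ⁻¹' {vert K v₀} :=
    { toFun := fun f => ⟨⟨vert K v₀, f⟩, rfl⟩
      invFun := fun z => z.1.2
      left_inv := fun _ => rfl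
      right_inv := by rintro ⟨⟨x, f⟩, hx⟩; obtain rfl : x = vert K v₀ := hx; rfl }
  have key : (cov.monodromyPerm (vert K v₀)).comp (edgeToLoop hT w hw) =
      (F.permCongrHom.toMonoidHom).comp (MulAction.toPermHom _ _) := by
    refine edgeGroup_hom_ext fun a b => Equiv.ext fun z => ?_
    obtain ⟨f, rfl⟩ := F.surjective z
    simp only [MonoidHom.comp_apply, edgeToLoop_edge]
    change cov.monodromy _ (F f) = F (edge _ _ a b * (F.symm (F f)))
    rw [Equiv.symm_apply_apply]
    by_cases h : ∃ s ∈ K.faces, a ∈ s ∧ b ∈ s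
    · obtain ⟨s, hs, ha, hb⟩ := h
      rw [edgeLoop_of_mem hT w hs ha hb]
      unfold closeUp
      change cov.monodromy ((Path.Homotopic.Quotient.trans _ _).trans _) ⟨⟨vert K v₀, f⟩, rfl⟩ = _
      rw [IsCoveringMap.monodromy_trans_apply, IsCoveringMap.monodromy_trans_apply, hwalk,
        monodromy_seg K _ hg s hs hb ha, hwalk']
      rfl
    · rw [edgeLoop_of_not hT w fun s hs ha hb => h ⟨s, hs, ha, hb⟩,
        edge_of_not fun s hs ha hb => h ⟨s, hs, ha, hb⟩, one_mul, FundamentalGroup.one_def]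
      exact congrFun cov.monodromy_refl _
  refine (injective_iff_map_eq_one _).2 fun e he => ?_
  have h1 := congrArg (fun φ => φ (F 1)) (DFunLike.congr_fun key e)
  simp only [MonoidHom.comp_apply, he, map_one] at h1
  have h2 : F 1 = F (e * F.symm (F 1)) := h1
  rw [Equiv.symm_apply_apply, mul_one] at h2
  exact (F.injective h2).symm

/-- The fundamental group of the realization is the edge group. -/
noncomputable def edgeGroupEquiv :
    EdgeGroup K.faces T ≃* FundamentalGroup (realization K) (vert K v₀) :=
  MulEquiv.ofBijective (edgeToLoop hT w hw) ⟨edgeToLoop_injective hT w hw,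
    edgeToLoop_surjective hT w hw⟩

end Main

/-! ### Spanning trees and connectedness of the 1-skeleton -/

section Graphs

/-- The graph of pairs of vertices contained in a common member of `S`. -/
def pairGraph {V : Type} (S : Set (Finset V)) : SimpleGraph V where
  Adj a b := a ≠ b ∧ ∃ s ∈ S, a ∈ s ∧ b ∈ s
  symm := ⟨fun _ _ ⟨h, s, hs, ha, hb⟩ => ⟨h.symm, s, hs, hb, ha⟩⟩
  loopless := ⟨fun _ h => h.1 rfl⟩

lemma exists_walks_of_isTree {V : Type} {T : SimpleGraph V} (hT : T.IsTree) (v₀ : V) :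
    ∃ w : ∀ a, T.Walk v₀ a, ∀ a b (h : T.Adj a b),
      w b = (w a).concat h ∨ w a = (w b).concat h.symm := by
  choose w hw using fun a => (hT.existsUnique_path v₀ a).exists
  refine ⟨w, fun a b h => ?_⟩
  by_cases hb : b ∈ (w a).support
  · exact Or.inr (hT.isAcyclic.path_concat (hw b) (hw a) h.symm hb)
  · exact Or.inl ((hT.existsUnique_path v₀ b).unique (hw b) ((hw a).concat hb h))

/-- The support of a point lies in one graph component. Hence the sum of the coordinates over a
component is continuous with values in `{0, 1}`; with two components it would take both. -/
lemma connected_pairGraph {ι : Type} [Fintype ι] (K : AbstractSimplicialComplex ι)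
    [PathConnectedSpace (realization K)] : (pairGraph K.faces).Connected := by
  classical
  obtain ⟨v₀, -⟩ := exists_pos (Classical.arbitrary (realization K))
  have : Nonempty ι := ⟨v₀⟩
  refine ⟨fun a b => ?_⟩
  by_contra hab
  let C : Finset ι := {v | (pairGraph K.faces).Reachable a v}
  let φ : realization K → ℝ := fun x => ∑ v ∈ C, x.1 v
  have hφ : Continuous φ := continuous_finsetSum _ fun v _ =>
    (continuous_apply v).comp continuous_subtype_val
  have h01 : ∀ x, φ x = 0 ∨ φ x = 1 := by
    intro x
    obtain ⟨s, hs, h⟩ := x.2.2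
    by_cases hc : ∃ v ∈ s, v ∈ C
    · right
      obtain ⟨v, hv, hvC⟩ := hc
      have h1 : ∀ u, u ∉ C → x.1 u = 0 := fun u hu => h u fun hus => hu <| by
        simp only [C, Finset.mem_filter, Finset.mem_univ, true_and] at hvC ⊢
        by_cases huv : v = u
        · exact huv ▸ hvC
        · exact hvC.trans (SimpleGraph.Adj.reachable ⟨huv, s, hs, hv, hus⟩)
      rw [← x.2.1.2]
      exact Finset.sum_subset (Finset.subset_univ _) fun u _ hu => h1 u hu
    · left
      exact Finset.sum_eq_zero fun v hv => h v fun hvs => hc ⟨v, hvs, hv⟩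
  have ha : φ (vert K a) = 1 := by
    have : a ∈ C := by simp [C]
    simp only [φ]
    rw [Finset.sum_eq_single a (fun v _ hv => vert_of_ne hv) (fun h => absurd this h), vert_self]
  have hb : φ (vert K b) = 0 := by
    refine Finset.sum_eq_zero fun v hv => vert_of_ne ?_
    rintro rfl
    exact hab (by simpa [C] using hv)
  obtain ⟨x, hx⟩ := mem_range_of_exists_le_of_exists_ge hφ (c := 1 / 2)
    ⟨_, hb.trans_le (by norm_num)⟩ ⟨_, (by norm_num : (1 / 2 : ℝ) ≤ 1).trans_eq ha.symm⟩
  rcases h01 x with h | h <;> rw [hx] at h <;> norm_num at h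

/-- An edge of an acyclic graph is a bridge, so its ends cannot be joined in a subgraph omitting it.
Hence extending a spanning forest of the triangles to a tree adds no edge of a triangle. -/
lemma adj_of_reachable_of_isAcyclic {V : Type} {F T : SimpleGraph V} (hT : T.IsAcyclic)
    (hF : F ≤ T) {a b : V} (h : T.Adj a b) (hr : F.Reachable a b) : F.Adj a b := by
  by_contra hn
  have h1 := SimpleGraph.isAcyclic_iff_forall_adj_isBridge.1 hT h
  rw [SimpleGraph.isBridge_iff] at h1
  refine h1 (hr.mono fun x y hxy => ?_)
  rw [SimpleGraph.deleteEdges_adj]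
  refine ⟨hF hxy, fun he => hn ?_⟩
  rw [Set.mem_singleton_iff, Sym2.eq_iff] at he
  rcases he with ⟨rfl, rfl⟩ | ⟨rfl, rfl⟩
  exacts [hxy, hxy.symm]

end Graphs

/-! ### Splitting off the edges outside the triangles -/

section Splitting

variable {ι : Type} {S D : Set (Finset ι)} {T F : SimpleGraph ι} (f : ι → ℕ)

/-- The edges of `S` which lie neither in the forest `T` nor in a member of `D`, each taken with
one orientation. -/
abbrev FreeEdge (S D : Set (Finset ι)) (T : SimpleGraph ι) (f : ι → ℕ) : Type :=
  {p : ι × ι // f p.1 < f p.2 ∧ (∃ s ∈ S, p.1 ∈ s ∧ p.2 ∈ s) ∧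
    (∀ s ∈ D, p.1 ∈ s → p.2 ∉ s) ∧ ¬ T.Adj p.1 p.2}

open Classical in
/-- The value of the splitting homomorphism on an edge. -/
noncomputable def splitFun (a b : ι) :
    Monoid.Coprod (EdgeGroup D F) (FreeGroup (FreeEdge S D T f)) :=
  if ∃ s ∈ D, a ∈ s ∧ b ∈ s then Monoid.Coprod.inl (edge D F a b) else
  if h : f a < f b ∧ (∃ s ∈ S, a ∈ s ∧ b ∈ s) ∧ (∀ s ∈ D, a ∈ s → b ∉ s) ∧ ¬ T.Adj a b then
    Monoid.Coprod.inr (FreeGroup.of ⟨(a, b), h⟩) else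
  if h : f b < f a ∧ (∃ s ∈ S, b ∈ s ∧ a ∈ s) ∧ (∀ s ∈ D, b ∈ s → a ∉ s) ∧ ¬ T.Adj b a then
    (Monoid.Coprod.inr (FreeGroup.of ⟨(b, a), h⟩))⁻¹ else 1

lemma splitFun_self (a : ι) : splitFun (S := S) (D := D) (T := T) (F := F) f a a = 1 := by
  unfold splitFun
  split_ifs with h1 h2
  · rw [edge_self, map_one]
  · exact absurd h2.1 (lt_irrefl _)
  · rfl

lemma splitFun_symm (a b : ι) :
    splitFun (S := S) (D := D) (T := T) (F := F) f a b * splitFun f b a = 1 := by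
  unfold splitFun
  by_cases h1 : ∃ s ∈ D, a ∈ s ∧ b ∈ s
  · have h1' : ∃ s ∈ D, b ∈ s ∧ a ∈ s := by
      obtain ⟨s, hs, ha, hb⟩ := h1
      exact ⟨s, hs, hb, ha⟩
    rw [if_pos h1, if_pos h1', ← map_mul, edge_symm a b, mul_inv_cancel, map_one]
  · have h1' : ¬ ∃ s ∈ D, b ∈ s ∧ a ∈ s := fun ⟨s, hs, hb, ha⟩ => h1 ⟨s, hs, ha, hb⟩
    rw [if_neg h1, if_neg h1']
    by_cases h2 : f a < f b ∧ (∃ s ∈ S, a ∈ s ∧ b ∈ s) ∧ (∀ s ∈ D, a ∈ s → b ∉ s) ∧ ¬ T.Adj a b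
    · have h3 : ¬ (f b < f a ∧ (∃ s ∈ S, b ∈ s ∧ a ∈ s) ∧ (∀ s ∈ D, b ∈ s → a ∉ s) ∧
        ¬ T.Adj b a) := fun h => lt_asymm h.1 h2.1
      rw [dif_pos h2, dif_neg h3, dif_pos h2, mul_inv_cancel]
    · by_cases h3 : f b < f a ∧ (∃ s ∈ S, b ∈ s ∧ a ∈ s) ∧ (∀ s ∈ D, b ∈ s → a ∉ s) ∧
        ¬ T.Adj b a
      · rw [dif_neg h2, dif_pos h3, dif_pos h3, inv_mul_cancel]
      · rw [dif_neg h2, dif_neg h3, dif_neg h3, dif_neg h2, mul_one]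

lemma eq_of_card_le_two {α : Type} {s : Finset α} (hs : s.card ≤ 2) {a b c : α} (ha : a ∈ s)
    (hb : b ∈ s) (hc : c ∈ s) : a = b ∨ b = c ∨ a = c := by
  classical
  by_contra! h
  have h1 : ({a, b, c} : Finset α) ⊆ s := by
    intro x hx
    simp only [Finset.mem_insert, Finset.mem_singleton] at hx
    rcases hx with rfl | rfl | rfl <;> assumption
  have h2 := Finset.card_le_card h1
  rw [Finset.card_eq_three.2 ⟨a, b, c, h.1, h.2.2, h.2.1, rfl⟩] at h2
  omega

/-- The splitting homomorphism. -/
noncomputable def split (hDS : D = {s | s ∈ S ∧ s.card = 3}) (hS : ∀ s ∈ S, s.card ≤ 3)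
    (hTF : ∀ a b, T.Adj a b → (∃ s ∈ D, a ∈ s ∧ b ∈ s) → F.Adj a b) :
    EdgeGroup S T →* Monoid.Coprod (EdgeGroup D F) (FreeGroup (FreeEdge S D T f)) :=
  edgeLift (splitFun f)
    (by
      intro a b h
      unfold splitFun
      split_ifs with h1 h2 h3
      · rw [edge_of_adj (hTF a b h h1), map_one]
      · exact absurd h h2.2.2.2
      · exact absurd h.symm h3.2.2.2
      · rfl)
    (by
      intro a b h
      unfold splitFun
      split_ifs with h1 h2 h3
      · obtain ⟨s, hs, ha, hb⟩ := h1
        subst hDS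
        exact absurd hb (h s hs.1 ha)
      · obtain ⟨s, hs, ha, hb⟩ := h2.2.1
        exact absurd hb (h s hs ha)
      · obtain ⟨s, hs, hb, ha⟩ := h3.2.1
        exact absurd hb (h s hs ha)
      · rfl)
    (by
      intro s hs a ha b hb c hc
      by_cases h3 : s.card = 3
      · have hsD : s ∈ D := hDS ▸ ⟨hs, h3⟩
        unfold splitFun
        rw [if_pos ⟨s, hsD, ha, hb⟩, if_pos ⟨s, hsD, hb, hc⟩, if_pos ⟨s, hsD, ha, hc⟩, ← map_mul,
          edge_mul hsD ha hb hc]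
      -- In a simplex with at most two vertices two of `a`, `b`, `c` coincide, so its relators only
      -- express inverses and triviality of degenerate edges.
      · have h4 := hS s hs
        rcases eq_of_card_le_two (by omega) ha hb hc with rfl | rfl | rfl
        · rw [splitFun_self, one_mul]
        · rw [splitFun_self, mul_one]
        · rw [splitFun_self, splitFun_symm])

open Classical in
/-- The inverse of the splitting homomorphism. -/
noncomputable def unsplit (hDS : D = {s | s ∈ S ∧ s.card = 3}) (hFT : F ≤ T) :
    Monoid.Coprod (EdgeGroup D F) (FreeGroup (FreeEdge S D T f)) →* EdgeGroup S T :=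
  Monoid.Coprod.lift
    (edgeLift (fun a b => if ∃ s ∈ D, a ∈ s ∧ b ∈ s then edge S T a b else 1)
      (by
        intro a b h
        split_ifs
        · exact edge_of_adj (hFT h)
        · rfl)
      (by
        intro a b h
        exact if_neg fun ⟨s, hs, ha, hb⟩ => h s hs ha hb)
      (by
        intro s hs a ha b hb c hc
        rw [if_pos ⟨s, hs, ha, hb⟩, if_pos ⟨s, hs, hb, hc⟩, if_pos ⟨s, hs, ha, hc⟩,
          edge_mul (hDS ▸ hs : s ∈ {s | s ∈ S ∧ s.card = 3}).1 ha hb hc]))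
    (FreeGroup.lift fun p => edge S T p.1.1 p.1.2)

/-- The edge group of a two-dimensional family of simplices is the free product of the edge group
of its triangles and the free group on the remaining edges. -/
noncomputable def splitEquiv (hf : Function.Injective f) (hDS : D = {s | s ∈ S ∧ s.card = 3})
    (hS : ∀ s ∈ S, s.card ≤ 3) (hFT : F ≤ T)
    (hTF : ∀ a b, T.Adj a b → (∃ s ∈ D, a ∈ s ∧ b ∈ s) → F.Adj a b) :
    EdgeGroup S T ≃* Monoid.Coprod (EdgeGroup D F) (FreeGroup (FreeEdge S D T f)) :=
  MonoidHom.toMulEquiv (split f hDS hS hTF) (unsplit f hDS hFT)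
    (by
      refine edgeGroup_hom_ext fun a b => ?_
      simp only [MonoidHom.comp_apply, MonoidHom.id_apply, split, edgeLift_edge]
      unfold splitFun
      split_ifs with h1 h2 h3
      · simp only [unsplit, Monoid.Coprod.lift_apply_inl, edgeLift_edge, if_pos h1]
      · simp only [unsplit, Monoid.Coprod.lift_apply_inr, FreeGroup.lift_apply_of]
      · simp only [unsplit, map_inv, Monoid.Coprod.lift_apply_inr, FreeGroup.lift_apply_of]
        exact (edge_symm b a).symm
      · rw [map_one]
        by_contra hne
        have e1 : a ≠ b := fun h => hne (by rw [h, edge_self])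
        have e2 : ¬ T.Adj a b := fun h => hne (edge_of_adj h).symm
        have e3 : ∃ s ∈ S, a ∈ s ∧ b ∈ s := by
          by_contra h
          exact hne (edge_of_not fun s hs ha hb => h ⟨s, hs, ha, hb⟩).symm
        rcases lt_trichotomy (f a) (f b) with h | h | h
        · exact h2 ⟨h, e3, fun s hs ha hb => h1 ⟨s, hs, ha, hb⟩, e2⟩
        · exact e1 (hf h)
        · obtain ⟨s, hs, ha, hb⟩ := e3
          exact h3 ⟨h, ⟨s, hs, hb, ha⟩, fun s hs hb ha => h1 ⟨s, hs, ha, hb⟩, fun h => e2 h.symm⟩)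
    (by
      refine Monoid.Coprod.hom_ext (edgeGroup_hom_ext fun a b => ?_)
        (FreeGroup.ext_hom _ _ fun p => ?_)
      · simp only [MonoidHom.comp_apply, MonoidHom.id_apply, unsplit, Monoid.Coprod.lift_apply_inl,
          edgeLift_edge]
        split_ifs with h1
        · simp only [split, edgeLift_edge]
          exact if_pos h1
        · rw [map_one, edge_of_not fun s hs ha hb => h1 ⟨s, hs, ha, hb⟩, map_one]
      · simp only [MonoidHom.comp_apply, MonoidHom.id_apply, unsplit, Monoid.Coprod.lift_apply_inr,
          FreeGroup.lift_apply_of, split, edgeLift_edge]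
        obtain ⟨⟨a, b⟩, h⟩ := p
        unfold splitFun
        rw [if_neg fun ⟨s, hs, ha, hb⟩ => h.2.2.1 s hs ha hb, dif_pos h])

end Splitting

/-! ### Invariance under relabelling of vertices -/

section Relabel

variable {V W : Type} (f : V ↪ W) (D : Set (Finset V)) (F : SimpleGraph W)

lemma exists_mem_map_iff {a b : V} :
    (∃ s ∈ Finset.map f '' D, f a ∈ s ∧ f b ∈ s) ↔ ∃ s ∈ D, a ∈ s ∧ b ∈ s := by
  simp

/-- Relabelling the vertices does not change the edge group. -/
noncomputable def relabel :
    EdgeGroup D (F.comap f) →* EdgeGroup (Finset.map f '' D) F :=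
  edgeLift (fun a b => edge _ _ (f a) (f b)) (fun _ _ h => edge_of_adj h)
    (fun a b h => edge_of_not fun s hs ha hb => by
      obtain ⟨t, ht, h1, h2⟩ := (exists_mem_map_iff f D).1 ⟨s, hs, ha, hb⟩
      exact h t ht h1 h2)
    (fun s hs a ha b hb c hc => edge_mul (Set.mem_image_of_mem (Finset.map f) hs) (by simpa) (by simpa)
      (by simpa))

open Classical in
/-- The inverse of relabelling. -/
noncomputable def unlabel [Nonempty V] :
    EdgeGroup (Finset.map f '' D) F →* EdgeGroup D (F.comap f) :=
  -- Off the range of `f` the value of `Function.invFun` is meaningless; the guard sends such pairs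
  -- to 1, as the relators require.
  edgeLift (fun x y => if ∃ s ∈ Finset.map f '' D, x ∈ s ∧ y ∈ s then
      edge _ _ (Function.invFun f x) (Function.invFun f y) else 1)
    (by
      intro x y h
      split_ifs with h1
      · obtain ⟨_, ⟨s, hs, rfl⟩, hx, hy⟩ := h1
        obtain ⟨a, -, rfl⟩ := Finset.mem_map.1 hx
        obtain ⟨b, -, rfl⟩ := Finset.mem_map.1 hy
        rw [Function.leftInverse_invFun f.injective, Function.leftInverse_invFun f.injective]
        exact edge_of_adj h
      · rfl)
    (fun x y h => if_neg fun ⟨s, hs, ha, hb⟩ => h s hs ha hb)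
    (by
      rintro _ ⟨s, hs, rfl⟩ x hx y hy z hz
      rw [if_pos ⟨_, ⟨s, hs, rfl⟩, hx, hy⟩, if_pos ⟨_, ⟨s, hs, rfl⟩, hy, hz⟩,
        if_pos ⟨_, ⟨s, hs, rfl⟩, hx, hz⟩]
      obtain ⟨a, ha, rfl⟩ := Finset.mem_map.1 hx
      obtain ⟨b, hb, rfl⟩ := Finset.mem_map.1 hy
      obtain ⟨c, hc, rfl⟩ := Finset.mem_map.1 hz
      simp only [Function.leftInverse_invFun f.injective _]
      exact edge_mul hs ha hb hc)

/-- Relabelling the vertices does not change the edge group. -/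
noncomputable def relabelEquiv [Nonempty V] :
    EdgeGroup D (F.comap f) ≃* EdgeGroup (Finset.map f '' D) F :=
  MonoidHom.toMulEquiv (relabel f D F) (unlabel f D F)
    (by
      refine edgeGroup_hom_ext fun a b => ?_
      simp only [MonoidHom.comp_apply, MonoidHom.id_apply, relabel, unlabel, edgeLift_edge]
      simp only [Function.leftInverse_invFun f.injective _]
      split_ifs with h
      · rfl
      · exact (edge_of_not fun s hs ha hb =>
          h ((exists_mem_map_iff f D).2 ⟨s, hs, ha, hb⟩)).symm)
    (by
      refine edgeGroup_hom_ext fun x y => ?_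
      simp only [MonoidHom.comp_apply, MonoidHom.id_apply, unlabel, edgeLift_edge]
      split_ifs with h
      · obtain ⟨_, ⟨s, hs, rfl⟩, hx, hy⟩ := h
        obtain ⟨a, -, rfl⟩ := Finset.mem_map.1 hx
        obtain ⟨b, -, rfl⟩ := Finset.mem_map.1 hy
        simp only [Function.leftInverse_invFun f.injective _, relabel, edgeLift_edge]
      · rw [map_one, edge_of_not fun s hs ha hb => h ⟨s, hs, ha, hb⟩])

lemma reachable_comap {f : V ↪ W} {F : SimpleGraph W}
    (hF : ∀ x y, F.Adj x y → y ∈ Set.range f) {x y : W} (p : F.Walk x y) :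
    ∀ a, f a = x → ∃ b, f b = y ∧ (F.comap f).Reachable a b := by
  induction p with
  | nil => exact fun a ha => ⟨a, ha, .rfl⟩
  | cons h p ih =>
    rintro a rfl
    obtain ⟨c, rfl⟩ := hF _ _ h
    obtain ⟨b, hb, hr⟩ := ih c rfl
    exact ⟨b, hb, .trans (SimpleGraph.Adj.reachable h) hr⟩

end Relabel

/-! ### Free index zero excludes free factors -/

section FreeIndex

/-- The free product with a trivial group. -/
noncomputable def coprodTrivial (G H : Type) [Group G] [Group H] [Unique H] :
    Monoid.Coprod G H ≃* G :=
  MonoidHom.toMulEquiv Monoid.Coprod.fst Monoid.Coprod.inl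
    (Monoid.Coprod.hom_ext rfl (MonoidHom.ext fun x => by
      rw [Subsingleton.elim x 1, map_one, map_one])) rfl

lemma HasFreeIndex.isEmpty_of_mulEquiv {G E R : Type} [Group G] [Group E] [Finite R]
    (hG : HasFreeIndex G 0) (e : G ≃* Monoid.Coprod E (FreeGroup R)) : IsEmpty R := by
  by_contra hR
  rw [not_isEmpty_iff] at hR
  obtain ⟨H, _, ⟨e1⟩, hH⟩ := hG
  obtain ⟨n, ⟨e2⟩⟩ := Finite.exists_equiv_fin R
  have hn : 0 < n := by
    rcases n.eq_zero_or_pos with rfl | h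
    · exact (e2 (Classical.arbitrary R)).elim0
    · exact h
  exact (hH E n hn).false ((coprodTrivial H _).symm.trans (e1.symm.trans (e.trans
    (MulEquiv.coprodCongr (MulEquiv.refl E) (FreeGroup.freeGroupCongr e2)))))

lemma hasFreeIndex_zero {G : Type} [Group G] (hG : HasNoFreeFactor G) : HasFreeIndex G 0 :=
  ⟨G, _, ⟨(coprodTrivial G _).symm⟩, hG⟩

end FreeIndex

/-! ### Groups of free index zero are determined by triangles -/

section Counting

/-- A spanning forest of the graph of a family of finite sets of natural numbers. -/
noncomputable def forest (D : Set (Finset ℕ)) : SimpleGraph ℕ :=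
  (pairGraph D).exists_isAcyclic_reachable_eq_le.choose

/-- The forest is chosen from `D` alone, so the edge group built from it is a function of `D`, as
the count requires. -/
lemma forest_spec (D : Set (Finset ℕ)) :
    forest D ≤ pairGraph D ∧ (forest D).IsAcyclic ∧
      (forest D).Reachable = (pairGraph D).Reachable :=
  (pairGraph D).exists_isAcyclic_reachable_eq_le.choose_spec

/-- A group of free index zero is the edge group of the triangles of any two-complex for it. -/
lemma IsTwoComplexFor.nonempty_mulEquiv {ι : Type} [Fintype ι] {K : AbstractSimplicialComplex ι}
    {G : Type} [Group G] (h : IsTwoComplexFor K G) (hG : HasFreeIndex G 0) (f : ι ↪ ℕ)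
    {D : Set (Finset ℕ)} (hD : D = Finset.map f '' {s | s ∈ K.faces ∧ s.card = 3}) :
    Nonempty (G ≃* EdgeGroup D (forest D)) := by
  obtain ⟨h3, hc, x, ⟨e⟩⟩ := h
  obtain ⟨v₀, -⟩ := exists_pos x
  have : Nonempty ι := ⟨v₀⟩
  obtain ⟨hF1, hF2, hF3⟩ := forest_spec D
  set F := (forest D).comap f with hF
  have hFadj : ∀ a b, F.Adj a b → a ≠ b ∧ ∃ s ∈ {s | s ∈ K.faces ∧ s.card = 3}, a ∈ s ∧ b ∈ s := by
    intro a b hab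
    obtain ⟨h1, h2⟩ := hF1 hab
    rw [hD, exists_mem_map_iff] at h2
    exact ⟨fun h => h1 (h ▸ rfl), h2⟩
  have hFK : F ≤ pairGraph K.faces := fun a b hab => by
    obtain ⟨h1, s, hs, h2⟩ := hFadj a b hab
    exact ⟨h1, s, hs.1, h2⟩
  -- The spanning tree of the whole complex extends the prescribed forest of the triangles, so both
  -- edge groups kill the same triangle edges.
  obtain ⟨T, hFT, hTK, hT⟩ :=
    (connected_pairGraph K).exists_isTree_le_of_le_of_isAcyclic hFK (hF2.of_comap f)
  obtain ⟨w, hw⟩ := exists_walks_of_isTree hT v₀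
  have hTF : ∀ a b, T.Adj a b → (∃ s ∈ {s | s ∈ K.faces ∧ s.card = 3}, a ∈ s ∧ b ∈ s) →
      F.Adj a b := by
    intro a b hab hs
    refine adj_of_reachable_of_isAcyclic hT.isAcyclic hFT hab ?_
    have h1 : (forest D).Reachable (f a) (f b) := by
      rw [hF3]
      refine SimpleGraph.Adj.reachable ⟨f.injective.ne hab.ne, ?_⟩
      rwa [hD, exists_mem_map_iff]
    obtain ⟨p⟩ := h1
    obtain ⟨b', hb', hr⟩ := reachable_comap (f := f) (fun x y hxy => by
      obtain ⟨-, s, hs, -, hy⟩ := hF1 hxy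
      rw [hD] at hs
      obtain ⟨t, -, rfl⟩ := hs
      obtain ⟨c, -, rfl⟩ := Finset.mem_map.1 hy
      exact ⟨c, rfl⟩) p a rfl
    rwa [f.injective hb'] at hr
  have e1 := edgeGroupEquiv (K := K) (fun a b hab => (hTK hab).2) w hw
  have e2 := FundamentalGroup.fundamentalGroupMulEquivOfPathConnected x (vert K v₀)
  have e3 := splitEquiv (S := K.faces) (T := T) (F := F) f f.injective rfl h3 hFT hTF
  have e4 : G ≃* _ := (e.symm.trans e2).trans (e1.symm.trans e3)
  have : Finite (FreeEdge K.faces {s | s ∈ K.faces ∧ s.card = 3} T f) :=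
    inferInstanceAs (Finite (Subtype _))
  have := hG.isEmpty_of_mulEquiv e4
  subst hD
  exact ⟨e4.trans ((coprodTrivial _ _).trans (relabelEquiv f _ _))⟩

end Counting

/-! ### The upper bound -/

section Counting

lemma exists_complex_of_kappa_le {G : Type} [Group G] {T : ℕ} (h : kappa G ≤ T) :
    ∃ (ι : Type) (_ : Fintype ι) (K : AbstractSimplicialComplex ι),
      IsTwoComplexFor K G ∧ numSimplices K 2 ≤ T := by
  have hne : {k : ℕ∞ | ∃ (ι : Type) (_ : Fintype ι) (K : AbstractSimplicialComplex ι),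
      IsTwoComplexFor K G ∧ k = (numSimplices K 2 : ℕ∞)}.Nonempty := by
    by_contra hn
    rw [Set.not_nonempty_iff_eq_empty] at hn
    rw [kappa, hn, sInf_empty, top_le_iff] at h
    exact ENat.natCast_ne_top T h
  obtain ⟨ι, hι, K, hK, hk⟩ := csInf_mem hne
  refine ⟨ι, hι, K, hK, ?_⟩
  rw [kappa, hk] at h
  exact_mod_cast h

/-- Vertices outside `W` are numbered from `W.card` on, which keeps the labelling injective while
the triangles use only small labels. -/
lemma exists_embedding_lt {ι : Type} [Finite ι] (W : Finset ι) :
    ∃ f : ι ↪ ℕ, ∀ a ∈ W, f a < W.card := by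
  classical
  obtain ⟨n, ⟨e⟩⟩ := Finite.exists_equiv_fin ι
  let e' := W.equivFin
  let f : ι → ℕ := fun a => if h : a ∈ W then e' ⟨a, h⟩ else W.card + e a
  have hlt : ∀ a ∈ W, f a < W.card := fun a ha => by simp [f, ha]
  refine ⟨⟨f, fun a b hab => ?_⟩, hlt⟩
  by_cases ha : a ∈ W <;> by_cases hb : b ∈ W
  · simp only [f, ha, hb, dif_pos] at hab
    simpa using e'.injective (Fin.ext hab)
  · have := hlt a ha
    rw [hab] at this
    simp [f, hb] at this
  · have := hlt b hb
    rw [← hab] at this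
    simp [f, ha] at this
  · simp only [f, ha, hb, dif_neg, not_false_iff] at hab
    exact e.injective (Fin.ext (by omega))

/-- The members of cardinality three of a finite sequence of finite sets. -/
def triangles {T : ℕ} (d : Fin T → Finset ℕ) : Set (Finset ℕ) :=
  {s | s ∈ Set.range d ∧ s.card = 3}

/-- The sets of three numbers below `3 * T`, and the empty set. -/
def labels (T : ℕ) : Finset (Finset ℕ) :=
  insert ∅ ((Finset.range (3 * T)).powersetCard 3)

/-- Unused entries are filled with `∅`, which `triangles` discards by its cardinality. -/
lemma exists_triangles_eq {T : ℕ} (D : Finset (Finset ℕ)) (hD : D.card ≤ T)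
    (h : ∀ s ∈ D, s.card = 3 ∧ ∀ a ∈ s, a < 3 * T) :
    ∃ d : Fin T → Finset ℕ, (∀ i, d i ∈ labels T) ∧ triangles d = D := by
  classical
  let e := D.equivFin.symm
  refine ⟨fun i => if hi : i.1 < D.card then e ⟨i, hi⟩ else ∅, fun i => ?_, ?_⟩
  · simp only [labels, Finset.mem_insert, Finset.mem_powersetCard]
    split_ifs with hi
    · have h1 := h _ (e ⟨i, hi⟩).2
      exact Or.inr ⟨fun a ha => Finset.mem_range.2 (h1.2 a ha), h1.1⟩
    · exact Or.inl rfl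
  · ext s
    constructor
    · rintro ⟨⟨i, rfl⟩, hs⟩
      dsimp only at hs ⊢
      split_ifs at hs ⊢
      · exact (e _).2
      · simp at hs
    · intro hs
      refine ⟨⟨⟨(e.symm ⟨s, hs⟩).1, (e.symm ⟨s, hs⟩).2.trans_le hD⟩, ?_⟩, (h s hs).1⟩
      simp

/-- The isomorphism class of the edge group of a finite sequence of triangles. -/
noncomputable def classOf {T : ℕ} (d : Fin T → Finset ℕ) : GroupClass :=
  groupClass (EdgeGroup (triangles d) (forest (triangles d)))

lemma groupClass_eq {G H : Type} [Group G] [Group H] (e : G ≃* H) :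
    groupClass G = groupClass H :=
  Quotient.sound ⟨e.toGrpIso⟩

lemma groupsUpTo_subset (T : ℕ) :
    groupsUpTo T ⊆ classOf ''
      ((Fintype.piFinset fun _ : Fin T => labels T : Finset _) : Set (Fin T → Finset ℕ)) := by
  classical
  rintro _ ⟨G, _, rfl, hG, hT⟩
  obtain ⟨ι, _, K, hK, hn⟩ := exists_complex_of_kappa_le hT
  let D₀ : Finset (Finset ι) := {s | s ∈ K.faces ∧ s.card = 3}
  have hD₀ : D₀.card ≤ T := by
    rw [numSimplices, Set.ncard_eq_toFinset_card'] at hn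
    refine le_trans (le_of_eq ?_) hn
    congr 1
    ext s
    simp [D₀]
  let W := D₀.biUnion id
  have hW : W.card ≤ 3 * T := by
    refine Finset.card_biUnion_le.trans ((Finset.sum_le_card_nsmul D₀ _ 3 fun s hs => ?_).trans ?_)
    · simp only [D₀, Finset.mem_filter] at hs
      exact hs.2.2.le
    · simp only [smul_eq_mul]
      omega
  obtain ⟨f, hf⟩ := exists_embedding_lt W
  obtain ⟨d, hd1, hd2⟩ := exists_triangles_eq (T := T) (D₀.image (Finset.map f))
    (Finset.card_image_le.trans hD₀) (by
      intro t ht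
      obtain ⟨s, hs, rfl⟩ := Finset.mem_image.1 ht
      refine ⟨?_, fun x hx => ?_⟩
      · simp only [D₀, Finset.mem_filter] at hs
        rw [Finset.card_map, hs.2.2]
      · obtain ⟨a, ha, rfl⟩ := Finset.mem_map.1 hx
        exact (hf a (Finset.mem_biUnion.2 ⟨s, hs, ha⟩)).trans_le hW)
  obtain ⟨e⟩ := hK.nonempty_mulEquiv hG f (D := triangles d) (by
    rw [hd2, Finset.coe_image]
    congr 1
    ext s
    simp [D₀])
  exact ⟨d, by simpa [Fintype.mem_piFinset] using hd1, (groupClass_eq e).symm⟩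

/-- From `C(3T,3) ≤ 27T³/6` and `T³ ≥ 8` one gets `4.5 T³ + 1 ≤ T⁶`. -/
lemma card_labels_le {T : ℕ} (hT : 2 ≤ T) : (labels T).card ≤ T ^ 6 := by
  refine (Finset.card_insert_le _ _).trans ?_
  rw [Finset.card_powersetCard, Finset.card_range]
  have h1 : (3 * T).choose 3 * 6 ≤ (3 * T) ^ 3 := by
    have h := Nat.descFactorial_le_pow (3 * T) 3
    rw [Nat.descFactorial_eq_factorial_mul_choose] at h
    simpa [Nat.factorial, mul_comm] using h
  have h2 : 8 ≤ T ^ 3 := by simpa using Nat.pow_le_pow_left hT 3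
  have h3 : (3 * T) ^ 3 = 27 * T ^ 3 := by ring
  have h4 : T ^ 6 = T ^ 3 * T ^ 3 := by ring
  nlinarith

lemma groupsUpTo_finite (T : ℕ) : (groupsUpTo T).Finite :=
  ((Finset.finite_toSet _).image _).subset (groupsUpTo_subset T)

lemma ncard_groupsUpTo_le {T : ℕ} (hT : 2 ≤ T) : (groupsUpTo T).ncard ≤ T ^ (6 * T) := by
  refine (Set.ncard_le_ncard (groupsUpTo_subset T) ((Finset.finite_toSet _).image _)).trans ?_
  refine (Set.ncard_image_le (Finset.finite_toSet _)).trans ?_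
  rw [Set.ncard_coe_finset, Fintype.card_piFinset, Finset.prod_const, Finset.card_univ,
    Fintype.card_fin, pow_mul]
  exact Nat.pow_le_pow_left (card_labels_le hT) T

lemma ncard_groupsUpTo_le_rpow {T : ℕ} (hT : 2 ≤ T) :
    ((groupsUpTo T).ncard : ℝ) ≤ (2 : ℝ) ^ (6 * (T : ℝ) * Real.logb 2 (T : ℝ)) := by
  have hT0 : (0 : ℝ) < T := by positivity
  rw [mul_comm, Real.rpow_mul (by norm_num), Real.rpow_logb (by norm_num) (by norm_num) hT0]
  have h : ((groupsUpTo T).ncard : ℝ) ≤ (T : ℝ) ^ (6 * T) := by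
    exact_mod_cast ncard_groupsUpTo_le hT
  refine h.trans (le_of_eq ?_)
  rw [← Real.rpow_natCast]
  push_cast
  rfl

end Counting

/-! ### The telescope: triangles and edge labels -/

section Telescope

/-- The vertices of the telescope with `k` stages. -/
inductive Vtx (k : ℕ) : Type
  | p | a | b | n
  | x (i : Fin (k + 1)) | y (i : Fin (k + 1))
  | z (i : Fin k)
  deriving DecidableEq, Fintype

open Vtx

/-- The numbers with leading binary digits `1, ε 0, ε 1, …`. -/
def horner (ε : ℕ → Bool) : ℕ → ℕ
  | 0 => 1
  | i + 1 => 2 * horner ε i + (ε i).toNat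

variable (ε : ℕ → Bool) (k : ℕ)

/-- The bottom of the telescope, with the triangle that closes the top. -/
def baseTri : List (Vtx k × Vtx k × Vtx k) :=
  -- Edges to `p` are in the tree, so the triangles at `p` make `a x₀` and `b y₀` trivial. The cone
  -- from `n` over the quadrilateral `a x₀ y₀ b` then gives `x₀ y₀` the class of `a b`.
  [(p, a, x 0), (p, b, y 0), (n, a, x 0), (n, b, a), (n, y 0, b), (n, x 0, y 0)]

variable {k} in
/-- A stage of the telescope. -/
def stepTri (i : Fin k) : List (Vtx k × Vtx k × Vtx k) :=
  -- The first four triangles give `xᵢ₊₁ yᵢ` and `xᵢ yᵢ₊₁` the class of `xᵢ yᵢ`. The cone from `zᵢ`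
  -- fills a polygon `xᵢ₊₁, yᵢ, …, xᵢ, yᵢ₊₁`, so `xᵢ₊₁ yᵢ₊₁` has twice that class plus the class of
  -- the piece from `yᵢ` to `xᵢ`. That piece runs through `a b`, adding one generator, if the digit
  -- is 1, and through `p`, adding nothing, if it is 0.
  [(p, y i.castSucc, y i.succ), (p, x i.succ, x i.castSucc),
    (x i.succ, x i.castSucc, y i.castSucc), (x i.castSucc, y i.castSucc, y i.succ),
    (z i, x i.succ, y i.castSucc), (z i, x i.castSucc, y i.succ), (z i, x i.succ, y i.succ)] ++
  if ε i then
    [(p, y i.castSucc, a), (p, b, x i.castSucc), (z i, y i.castSucc, a), (z i, a, b),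
      (z i, b, x i.castSucc)]
  else
    [(z i, y i.castSucc, p), (z i, p, x i.castSucc)]

variable {k} in
/-- The parent of a vertex in the spanning tree. -/
def parent : Vtx k → Vtx k
  | n => a
  | z i => x i.succ
  | _ => p

/-- The triangles of the telescope whose boundary is homologically trivial. -/
def openTri : List (Vtx k × Vtx k × Vtx k) :=
  baseTri k ++ (List.finRange k).flatMap (stepTri ε)

/-- The triangles of the telescope. -/
def allTri : List (Vtx k × Vtx k × Vtx k) :=
  (p, x (Fin.last k), y (Fin.last k)) :: openTri ε k

variable {k} in
/-- Half of the edge labelling. -/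
def halfLabel : Vtx k → Vtx k → ℤ
  | a, b => 1
  | x i, y j => if j.1 = i.1 ∨ j.1 = i.1 + 1 then horner ε i else
      if i.1 = j.1 + 1 then horner ε j else 0
  | n, b => 1
  | n, y _ => 1
  | z i, p => horner ε i
  | z i, a => horner ε i
  | z i, b => horner ε i + 1
  | z i, x j => if j.1 = i.1 then horner ε i + (ε i).toNat else 0
  | z i, y j => if j.1 = i.1 then horner ε i else horner ε (i + 1)
  | _, _ => 0

variable {k} in
/-- The label of an ordered pair of vertices. -/
def label (u v : Vtx k) : ℤ := halfLabel ε u v - halfLabel ε v u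

variable {k} in
lemma label_parent (v : Vtx k) : label ε v (parent v) = 0 := by
  cases v <;> simp [label, parent, halfLabel]

variable {k} in
lemma label_of_mem_stepTri (i : Fin k) :
    ∀ t ∈ stepTri ε i, label ε t.1 t.2.1 + label ε t.2.1 t.2.2 = label ε t.1 t.2.2 := by
  unfold stepTri
  cases h : ε i <;> (simp [label, halfLabel, horner, h]; try ring_nf; simp)

/-- The closing triangle is left out because its labels violate the cocycle identity by `horner ε
k`; on the whole telescope the identity holds only modulo that number. -/
lemma label_of_mem_openTri :
    ∀ t ∈ openTri ε k, label ε t.1 t.2.1 + label ε t.2.1 t.2.2 = label ε t.1 t.2.2 := by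
  intro t ht
  rw [openTri, List.mem_append, List.mem_flatMap] at ht
  rcases ht with ht | ⟨i, -, ht⟩
  · revert t
    simp [baseTri, label, halfLabel, horner]
  · exact label_of_mem_stepTri ε i t ht

end Telescope

/-! ### The telescope has fundamental group `ℤ/m` -/

section Telescope

open Vtx

variable (ε : ℕ → Bool) (k : ℕ)

/-- The set of vertices of a triple. -/
def simplex {V : Type} [DecidableEq V] (t : V × V × V) : Finset V := {t.1, t.2.1, t.2.2}

/-- The triples spanning the telescope: triangles and tree edges. -/
def generators : Set (Vtx k × Vtx k × Vtx k) :=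
  {t | t ∈ allTri ε k ∨ ∃ v, t = (v, parent v, parent v)}

/-- The telescope. -/
def telescope : AbstractSimplicialComplex (Vtx k) where
  faces := {s | s.Nonempty ∧ ∃ t ∈ generators ε k, s ⊆ simplex t}
  isRelLowerSet_faces := fun _ ⟨hs, t, ht, hst⟩ =>
    ⟨hs, fun _ hs' hne => ⟨hne, t, ht, hs'.trans hst⟩⟩
  singleton_mem v := ⟨Finset.singleton_nonempty v, _, Or.inr ⟨v, rfl⟩, by simp [simplex]⟩

lemma simplex_mem_faces {t : Vtx k × Vtx k × Vtx k} (ht : t ∈ generators ε k) :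
    simplex t ∈ (telescope ε k).faces :=
  ⟨⟨t.1, by simp [simplex]⟩, t, ht, subset_rfl⟩

lemma card_le_three_of_mem_telescope : ∀ s ∈ (telescope ε k).faces, s.card ≤ 3 := by
  rintro s ⟨-, t, -, hst⟩
  exact (Finset.card_le_card hst).trans Finset.card_le_three

/-- A face with three vertices is a whole generating triple, and the degenerate triples of tree
edges have at most two vertices. -/
lemma numSimplices_telescope_le : numSimplices (telescope ε k) 2 ≤ (allTri ε k).length := by
  classical
  have h : {s : Finset (Vtx k) | s ∈ (telescope ε k).faces ∧ s.card = 2 + 1} ⊆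
      (((allTri ε k).map simplex).toFinset : Set (Finset (Vtx k))) := by
    rintro s ⟨⟨-, t, ht, hst⟩, hs⟩
    have h3 : s = simplex t :=
      Finset.eq_of_subset_of_card_le hst (Finset.card_le_three.trans hs.ge)
    rcases ht with ht | ⟨v, rfl⟩
    · simp only [List.coe_toFinset, List.mem_map, Set.mem_ofPred_eq]
      exact ⟨t, ht, h3.symm⟩
    · rw [h3] at hs
      have : (simplex (v, parent v, parent v)).card ≤ 2 := by
        simpa [simplex] using Finset.card_le_two
      omega
  refine (Set.ncard_le_ncard h (Finset.finite_toSet _)).trans ?_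
  rw [Set.ncard_coe_finset]
  exact (List.toFinset_card_le _).trans (by simp)

lemma length_allTri :
    (allTri ε k).length = 7 + ∑ i ∈ Finset.range k, if ε i then 12 else 9 := by
  have h : ∀ i : Fin k, (stepTri ε i).length = if ε i then 12 else 9 := fun i => by
    unfold stepTri
    split_ifs <;> rfl
  rw [allTri, openTri, List.length_cons, List.length_append, List.length_flatMap,
    Finset.sum_range fun i => if ε i then 12 else 9, Fin.sum_univ_def]
  simp only [h, baseTri, List.length_cons, List.length_nil]
  omega

/-- The spanning tree of the telescope. -/
def tree : SimpleGraph (Vtx k) := SimpleGraph.fromRel fun u v => v = parent u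

variable {k}

lemma tree_adj {v : Vtx k} (h : parent v ≠ v) : (tree k).Adj (parent v) v := by
  simp [tree, h]

/-- The path in the spanning tree from the root to a vertex. -/
def treeWalk : ∀ v : Vtx k, (tree k).Walk p v
  | p => .nil
  | a => .cons (tree_adj (v := a) (by simp [parent])) .nil
  | b => .cons (tree_adj (v := b) (by simp [parent])) .nil
  | x i => .cons (tree_adj (v := x i) (by simp [parent])) .nil
  | y i => .cons (tree_adj (v := y i) (by simp [parent])) .nil
  | n => .cons (tree_adj (v := a) (by simp [parent]))
      (.cons (tree_adj (v := n) (by simp [parent])) .nil)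
  | z i => .cons (tree_adj (v := x i.succ) (by simp [parent]))
      (.cons (tree_adj (v := z i) (by simp [parent])) .nil)

lemma treeWalk_eq_concat : ∀ (v : Vtx k) (h : (tree k).Adj (parent v) v),
    treeWalk v = (treeWalk (parent v)).concat h
  | p, h => absurd rfl h.ne
  | a, _ => rfl
  | b, _ => rfl
  | x _, _ => rfl
  | y _, _ => rfl
  | n, _ => rfl
  | z _, _ => rfl

lemma treeWalk_spec (u v : Vtx k) (h : (tree k).Adj u v) :
    treeWalk v = (treeWalk u).concat h ∨ treeWalk u = (treeWalk v).concat h.symm := by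
  rcases h.2 with rfl | rfl
  · exact Or.inr (treeWalk_eq_concat _ _)
  · exact Or.inl (treeWalk_eq_concat _ _)

lemma exists_face_of_tree_adj (u v : Vtx k) (h : (tree k).Adj u v) :
    ∃ s ∈ (telescope ε k).faces, u ∈ s ∧ v ∈ s := by
  rcases h.2 with rfl | rfl
  · exact ⟨_, simplex_mem_faces ε k (Or.inr ⟨u, rfl⟩), by simp [simplex], by simp [simplex]⟩
  · exact ⟨_, simplex_mem_faces ε k (Or.inr ⟨v, rfl⟩), by simp [simplex], by simp [simplex]⟩

/-- The edge group of the telescope. -/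
abbrev TelescopeGroup (ε : ℕ → Bool) (k : ℕ) : Type := EdgeGroup (telescope ε k).faces (tree k)

lemma label_symm (u v : Vtx k) : label ε v u = -label ε u v := by
  simp [label]

/-- The labels of a triple form a cocycle modulo `horner ε k`. -/
lemma label_of_mem_generators {t : Vtx k × Vtx k × Vtx k} (ht : t ∈ generators ε k) :
    (label ε t.1 t.2.1 + label ε t.2.1 t.2.2 : ZMod (horner ε k)) = label ε t.1 t.2.2 := by
  rcases ht with ht | ⟨v, rfl⟩
  · rw [allTri, List.mem_cons] at ht
    rcases ht with rfl | ht
    · simp [label, halfLabel]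
    · exact_mod_cast congrArg (Int.cast : ℤ → ZMod (horner ε k)) (label_of_mem_openTri ε k t ht)
  · simp [label]

open Classical in
/-- The homomorphism from the edge group of the telescope given by the edge labels. -/
noncomputable def labelHom : TelescopeGroup ε k →* Multiplicative (ZMod (horner ε k)) :=
  edgeLift (fun u v => if ∃ s ∈ (telescope ε k).faces, u ∈ s ∧ v ∈ s then
      Multiplicative.ofAdd (label ε u v : ZMod (horner ε k)) else 1)
    (by
      intro u v h
      split_ifs
      · rcases h.2 with rfl | rfl
        · rw [label_parent]; simp
        · rw [label_symm, label_parent]; simp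
      · rfl)
    (fun u v h => if_neg fun ⟨s, hs, hu, hv⟩ => h s hs hu hv)
    (by
      rintro s hs u hu v hv w hw
      rw [if_pos ⟨s, hs, hu, hv⟩, if_pos ⟨s, hs, hv, hw⟩, if_pos ⟨s, hs, hu, hw⟩, ← ofAdd_add]
      congr 1
      obtain ⟨-, t, ht, hst⟩ := hs
      have h1 := label_of_mem_generators ε ht
      have hs1 : ∀ u v : Vtx k, (label ε v u : ZMod (horner ε k)) = -label ε u v := fun u v => by
        rw [label_symm]; simp
      have hs0 : ∀ u : Vtx k, (label ε u u : ZMod (horner ε k)) = 0 := fun u => by simp [label]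
      replace hu := hst hu
      replace hv := hst hv
      replace hw := hst hw
      simp only [simplex, Finset.mem_insert, Finset.mem_singleton] at hu hv hw
      have h21 := hs1 t.1 t.2.1
      have h32 := hs1 t.2.1 t.2.2
      have h31 := hs1 t.1 t.2.2
      rcases hu with rfl | rfl | rfl <;> rcases hv with rfl | rfl | rfl <;>
        rcases hw with rfl | rfl | rfl <;>
        simp only [hs0, h21, h32, h31, ← h1] <;> ring)

lemma labelHom_edge {u v : Vtx k} (h : ∃ s ∈ (telescope ε k).faces, u ∈ s ∧ v ∈ s) :
    labelHom ε (edge _ _ u v) = Multiplicative.ofAdd (label ε u v : ZMod (horner ε k)) := by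
  rw [labelHom, edgeLift_edge, if_pos h]

/-- An edge whose class is the power of the generator prescribed by its label. -/
def IsLabelled (u v : Vtx k) : Prop :=
  edge (telescope ε k).faces (tree k) u v = edge (telescope ε k).faces (tree k) a b ^ label ε u v

lemma IsLabelled.symm {u v : Vtx k} (h : IsLabelled ε u v) : IsLabelled ε v u := by
  rw [IsLabelled, edge_symm u v, label_symm, zpow_neg, h]

lemma isLabelled_parent (v : Vtx k) : IsLabelled ε v (parent v) := by
  rw [IsLabelled, label_parent, zpow_zero]
  by_cases h : parent v = v
  · rw [h, edge_self]
  · exact edge_of_adj (tree_adj h).symm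

lemma isLabelled_root_x (i : Fin (k + 1)) : IsLabelled ε p (x i) :=
  (isLabelled_parent ε (x i)).symm

lemma isLabelled_root_y (i : Fin (k + 1)) : IsLabelled ε p (y i) :=
  (isLabelled_parent ε (y i)).symm

/-- The edges of a triple are labelled. -/
def TriLabelled (t : Vtx k × Vtx k × Vtx k) : Prop :=
  IsLabelled ε t.1 t.2.1 ∧ IsLabelled ε t.2.1 t.2.2 ∧ IsLabelled ε t.1 t.2.2

variable {ε}

lemma edge_mul_of_mem_generators {t : Vtx k × Vtx k × Vtx k} (ht : t ∈ generators ε k) :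
    edge (telescope ε k).faces (tree k) t.1 t.2.1 * edge _ _ t.2.1 t.2.2 = edge _ _ t.1 t.2.2 :=
  edge_mul (simplex_mem_faces ε k ht) (by simp [simplex]) (by simp [simplex]) (by simp [simplex])

section

variable {u v w : Vtx k} (ht : (u, v, w) ∈ openTri ε k)
include ht

/-- The labels are an integral cocycle on open triangles, so two labelled edges of such a triangle
force the third. Labels thus spread from the tree edges and `a b` to all edges. -/
lemma triLabelled_of_fst_snd (h1 : IsLabelled ε u v) (h2 : IsLabelled ε v w) :
    TriLabelled ε (u, v, w) := by
  refine ⟨h1, h2, ?_⟩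
  have h := edge_mul_of_mem_generators (Or.inl (List.mem_cons_of_mem _ ht))
  dsimp only at h ⊢
  rw [IsLabelled, ← h, h1, h2, ← zpow_add, label_of_mem_openTri ε k _ ht]

lemma triLabelled_of_fst_trd (h1 : IsLabelled ε u v) (h3 : IsLabelled ε u w) :
    TriLabelled ε (u, v, w) := by
  refine ⟨h1, ?_, h3⟩
  have h := edge_mul_of_mem_generators (Or.inl (List.mem_cons_of_mem _ ht))
  dsimp only at h ⊢
  rw [IsLabelled, ← mul_right_inj, h, h1, h3, ← zpow_add, label_of_mem_openTri ε k _ ht]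

lemma triLabelled_of_snd_trd (h2 : IsLabelled ε v w) (h3 : IsLabelled ε u w) :
    TriLabelled ε (u, v, w) := by
  refine ⟨?_, h2, h3⟩
  have h := edge_mul_of_mem_generators (Or.inl (List.mem_cons_of_mem _ ht))
  dsimp only at h ⊢
  rw [IsLabelled, ← mul_left_inj, h, h2, h3, ← zpow_add, label_of_mem_openTri ε k _ ht]

end

lemma isLabelled_generator : IsLabelled ε (a : Vtx k) b := by
  simp [IsLabelled, label, halfLabel]

lemma mem_openTri_of_mem_baseTri {t : Vtx k × Vtx k × Vtx k} (ht : t ∈ baseTri k) :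
    t ∈ openTri ε k := List.mem_append_left _ ht

lemma mem_openTri_of_mem_stepTri {t : Vtx k × Vtx k × Vtx k} {i : Fin k} (ht : t ∈ stepTri ε i) :
    t ∈ openTri ε k :=
  List.mem_append_right _ (List.mem_flatMap.2 ⟨i, List.mem_finRange i, ht⟩)

lemma triLabelled_baseTri : ∀ t ∈ baseTri k, TriLabelled ε t := by
  have hmem : ∀ t ∈ baseTri k, t ∈ openTri ε k := fun _ => mem_openTri_of_mem_baseTri
  simp only [baseTri, List.forall_mem_cons] at hmem ⊢
  obtain ⟨m1, m2, m3, m4, m5, m6, -⟩ := hmem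
  have t1 := triLabelled_of_fst_trd m1 (isLabelled_parent ε a).symm (isLabelled_root_x ε _)
  have t2 := triLabelled_of_fst_trd m2 (isLabelled_parent ε b).symm (isLabelled_root_y ε _)
  have t3 := triLabelled_of_fst_snd m3 (isLabelled_parent ε n) t1.2.1
  have t4 := triLabelled_of_snd_trd m4 isLabelled_generator.symm (isLabelled_parent ε n)
  have t5 := triLabelled_of_snd_trd m5 t2.2.1.symm t4.1
  have t6 := triLabelled_of_fst_trd m6 t3.2.2 t5.1
  exact ⟨t1, t2, t3, t4, t5, t6, by simp⟩

lemma triLabelled_stepTri (i : Fin k) (h : IsLabelled ε (x i.castSucc) (y i.castSucc)) :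
    ∀ t ∈ stepTri ε i, TriLabelled ε t := by
  have hmem : ∀ t ∈ stepTri ε i, t ∈ openTri ε k := fun _ => mem_openTri_of_mem_stepTri
  unfold stepTri at hmem ⊢
  split_ifs at hmem ⊢
  · simp only [List.cons_append, List.nil_append, List.forall_mem_cons] at hmem ⊢
    obtain ⟨m1, m2, m3, m4, m5, m6, m7, m8, m9, m10, m11, m12, -⟩ := hmem
    have t1 := triLabelled_of_fst_trd m1 (isLabelled_root_y ε _) (isLabelled_root_y ε _)
    have t2 := triLabelled_of_fst_trd m2 (isLabelled_root_x ε _) (isLabelled_root_x ε _)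
    have t3 := triLabelled_of_fst_snd m3 t2.2.1 h
    have t4 := triLabelled_of_fst_snd m4 h t1.2.1
    have t5 := triLabelled_of_fst_snd m5 (isLabelled_parent ε (z i)) t3.2.2
    have t8 := triLabelled_of_fst_trd m8 (isLabelled_root_y ε _) (isLabelled_parent ε a).symm
    have t9 := triLabelled_of_fst_trd m9 (isLabelled_parent ε b).symm (isLabelled_root_x ε _)
    have t10 := triLabelled_of_fst_snd m10 t5.2.2 t8.2.1
    have t11 := triLabelled_of_fst_snd m11 t10.2.2 isLabelled_generator
    have t12 := triLabelled_of_fst_snd m12 t11.2.2 t9.2.1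
    -- The polygon around `zᵢ` is traversed from `xᵢ₊₁`; the sixth and seventh triangles close it
    -- and so come last.
    have t6 := triLabelled_of_fst_snd m6 t12.2.2 t4.2.2
    have t7 := triLabelled_of_fst_trd m7 (isLabelled_parent ε (z i)) t6.2.2
    exact ⟨t1, t2, t3, t4, t5, t6, t7, t8, t9, t10, t11, t12, by simp⟩
  · simp only [List.cons_append, List.nil_append, List.forall_mem_cons] at hmem ⊢
    obtain ⟨m1, m2, m3, m4, m5, m6, m7, m8, m9, -⟩ := hmem
    have t1 := triLabelled_of_fst_trd m1 (isLabelled_root_y ε _) (isLabelled_root_y ε _)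
    have t2 := triLabelled_of_fst_trd m2 (isLabelled_root_x ε _) (isLabelled_root_x ε _)
    have t3 := triLabelled_of_fst_snd m3 t2.2.1 h
    have t4 := triLabelled_of_fst_snd m4 h t1.2.1
    have t5 := triLabelled_of_fst_snd m5 (isLabelled_parent ε (z i)) t3.2.2
    have t8 := triLabelled_of_fst_snd m8 t5.2.2 (isLabelled_parent ε (y _))
    have t9 := triLabelled_of_fst_snd m9 t8.2.2 (isLabelled_root_x ε _)
    have t6 := triLabelled_of_fst_snd m6 t9.2.2 t4.2.2
    have t7 := triLabelled_of_fst_trd m7 (isLabelled_parent ε (z i)) t6.2.2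
    exact ⟨t1, t2, t3, t4, t5, t6, t7, t8, t9, by simp⟩

lemma isLabelled_stage (i : Fin (k + 1)) : IsLabelled ε (x i) (y i) := by
  induction i using Fin.induction with
  | zero => exact (triLabelled_baseTri (n, x 0, y 0) (by simp [baseTri])).2.1
  | succ i ih =>
    exact (triLabelled_stepTri i ih (z i, x i.succ, y i.succ) (by simp [stepTri])).2.1

lemma triLabelled_of_mem_generators {t : Vtx k × Vtx k × Vtx k} (ht : t ∈ generators ε k) :
    TriLabelled ε t := by
  rcases ht with ht | ⟨v, rfl⟩
  · rw [allTri, List.mem_cons, openTri, List.mem_append, List.mem_flatMap] at ht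
    rcases ht with rfl | ht | ⟨i, -, ht⟩
    · exact ⟨(isLabelled_parent ε (x _)).symm, isLabelled_stage _, (isLabelled_parent ε (y _)).symm⟩
    · exact triLabelled_baseTri t ht
    · exact triLabelled_stepTri i (isLabelled_stage _) t ht
  · exact ⟨isLabelled_parent ε v, by simp [IsLabelled, edge_self, label], isLabelled_parent ε v⟩

lemma isLabelled_of_mem_face {s : Finset (Vtx k)} (hs : s ∈ (telescope ε k).faces) {u v : Vtx k}
    (hu : u ∈ s) (hv : v ∈ s) : IsLabelled ε u v := by
  obtain ⟨-, t, ht, hst⟩ := hs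
  obtain ⟨h1, h2, h3⟩ := triLabelled_of_mem_generators ht
  have h0 : ∀ u : Vtx k, IsLabelled ε u u := fun u => by simp [IsLabelled, edge_self, label]
  replace hu := hst hu
  replace hv := hst hv
  simp only [simplex, Finset.mem_insert, Finset.mem_singleton] at hu hv
  rcases hu with rfl | rfl | rfl <;> rcases hv with rfl | rfl | rfl
  exacts [h0 _, h1, h3, h1.symm, h0 _, h2, h3.symm, h2.symm, h0 _]

lemma mem_zpowers_edge (g : TelescopeGroup ε k) :
    g ∈ Subgroup.zpowers (edge (telescope ε k).faces (tree k) a b) := by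
  refine PresentedGroup.generated_by _ _ (fun q => ?_) g
  change edge (telescope ε k).faces (tree k) q.1 q.2 ∈ _
  by_cases h : ∃ s ∈ (telescope ε k).faces, q.1 ∈ s ∧ q.2 ∈ s
  · obtain ⟨s, hs, hu, hv⟩ := h
    rw [isLabelled_of_mem_face hs hu hv]
    exact Subgroup.zpow_mem_zpowers _ _
  · rw [edge_of_not fun s hs hu hv => h ⟨s, hs, hu, hv⟩]
    exact one_mem _

lemma edge_zpow_horner :
    edge (telescope ε k).faces (tree k) a b ^ (horner ε k : ℤ) = 1 := by
  have h := edge_mul_of_mem_generators (ε := ε) (t := (p, x (Fin.last k), y (Fin.last k)))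
    (Or.inl List.mem_cons_self)
  dsimp only at h
  have h1 := isLabelled_root_x ε (Fin.last k)
  have h2 := isLabelled_root_y ε (Fin.last k)
  have h3 := isLabelled_stage (ε := ε) (Fin.last k)
  rw [h1, h2, h3] at h
  simpa [label, halfLabel] using h

lemma labelHom_generator :
    labelHom ε (edge _ _ (a : Vtx k) b) = Multiplicative.ofAdd (1 : ZMod (horner ε k)) := by
  rw [labelHom_edge]
  · simp [label, halfLabel]
  · exact ⟨_, simplex_mem_faces ε k (t := (n, b, a))
      (Or.inl (List.mem_cons_of_mem _ (mem_openTri_of_mem_baseTri (by simp [baseTri])))),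
      by simp [simplex], by simp [simplex]⟩

/-- The edge `a b` generates the group, its `horner ε k`-th power is killed by the closing triangle,
and it is sent to the generator 1. -/
lemma labelHom_bijective : Function.Bijective (labelHom ε (k := k)) := by
  constructor
  · refine (injective_iff_map_eq_one _).2 fun g hg => ?_
    obtain ⟨j, rfl⟩ := mem_zpowers_edge g
    dsimp only at hg ⊢
    rw [map_zpow, labelHom_generator, ← ofAdd_zsmul, ← ofAdd_zero,
      Multiplicative.ofAdd.injective.eq_iff, zsmul_one, ZMod.intCast_zmod_eq_zero_iff_dvd] at hg
    obtain ⟨c, rfl⟩ := hg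
    rw [zpow_mul, edge_zpow_horner, one_zpow]
  · intro c
    obtain ⟨j, hj⟩ := ZMod.intCast_surjective c.toAdd
    refine ⟨edge _ _ a b ^ j, ?_⟩
    rw [map_zpow, labelHom_generator, ← ofAdd_zsmul, zsmul_one, hj]
    rfl

lemma isTwoComplexFor_telescope :
    IsTwoComplexFor (telescope ε k) (Multiplicative (ZMod (horner ε k))) := by
  refine ⟨card_le_three_of_mem_telescope ε k,
    pathConnectedSpace_of_walks p treeWalk (exists_face_of_tree_adj ε), vert _ p, ⟨?_⟩⟩
  exact (edgeGroupEquiv (exists_face_of_tree_adj ε) treeWalk treeWalk_spec).symm.trans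
    (MulEquiv.ofBijective (labelHom ε) labelHom_bijective)

lemma kappa_zmod_horner_le :
    kappa (Multiplicative (ZMod (horner ε k))) ≤
      ((7 + ∑ i ∈ Finset.range k, if ε i then 12 else 9 : ℕ) : ℕ∞) := by
  refine le_trans (sInf_le ⟨_, _, _, isTwoComplexFor_telescope (ε := ε) (k := k), rfl⟩) ?_
  rw [← length_allTri]
  exact_mod_cast numSimplices_telescope_le ε k

end Telescope

/-! ### The lower bound -/

section LowerBound

lemma horner_congr {ε ε' : ℕ → Bool} {k : ℕ} (h : ∀ i < k, ε i = ε' i) :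
    horner ε k = horner ε' k := by
  induction k with
  | zero => rfl
  | succ k ih => rw [horner, horner, ih fun i hi => h i (by omega), h k (by omega)]

/-- A number with at least two binary digits is the value of a telescope with few triangles. -/
lemma exists_horner_eq (m : ℕ) (hm : 2 ≤ m) : ∃ (ε : ℕ → Bool) (k : ℕ), horner ε k = m ∧
    2 ^ (7 + ∑ i ∈ Finset.range k, if ε i then 12 else 9) ≤ 8 * m ^ 14 := by
  induction m using Nat.strong_induction_on with
  | _ m ih =>
    -- The induction starts with one digit after the leading 1, with 16 or 19 triangles. For `m = 1`
    -- the bound would read `2^7 ≤ 8`, so the trivial group is realized by a point instead.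
    by_cases h4 : m < 4
    · refine ⟨fun _ => decide (m = 3), 1, ?_, ?_⟩
      · interval_cases m <;> rfl
      · interval_cases m <;> simp
    · obtain ⟨ε, k, h1, h2⟩ := ih (m / 2) (by omega) (by omega)
      let ε' := Function.update ε k (decide (m % 2 = 1))
      have h3 : ∀ i < k, ε' i = ε i := fun i hi => Function.update_of_ne hi.ne _ _
      refine ⟨ε', k + 1, ?_, ?_⟩
      · rw [horner, horner_congr h3, h1]
        simp only [ε', Function.update_self]
        rcases Nat.mod_two_eq_zero_or_one m with h | h <;> simp [h] <;> omega
      · rw [Finset.sum_range_succ, ← add_assoc, Finset.sum_congr rfl (g := fun i =>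
          if ε i then 12 else 9) fun i hi => by rw [h3 i (Finset.mem_range.1 hi)], pow_add]
        -- A new digit costs at most 12 triangles, within the factor `2^14` gained in `m^14` by
        -- doubling.
        have h5 : 2 ^ (if ε' k then 12 else 9) ≤ 2 ^ 14 :=
          Nat.pow_le_pow_right (by norm_num) (by split_ifs <;> norm_num)
        calc _ ≤ 8 * (m / 2) ^ 14 * 2 ^ 14 := Nat.mul_le_mul h2 h5
          _ = 8 * (m / 2 * 2) ^ 14 := by rw [mul_pow, mul_assoc]
          _ ≤ 8 * m ^ 14 := by
            gcongr
            exact Nat.div_mul_le_self m 2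

/-- The complex consisting of a point. -/
def pointComplex : AbstractSimplicialComplex Unit where
  faces := {s | s.Nonempty}
  isRelLowerSet_faces := fun _ hs => ⟨hs, fun _ _ h => h⟩
  singleton_mem _ := Finset.singleton_nonempty _

lemma isTwoComplexFor_pointComplex {G : Type} [Group G] [Unique G] :
    IsTwoComplexFor pointComplex G := by
  have hT : ∀ u v : Unit, (⊥ : SimpleGraph Unit).Adj u v →
      ∃ s ∈ pointComplex.faces, u ∈ s ∧ v ∈ s := fun _ _ h => absurd h (by simp)
  let w : ∀ u : Unit, (⊥ : SimpleGraph Unit).Walk () u := fun _ => .nil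
  have hsub : ∀ g : EdgeGroup pointComplex.faces ⊥, g = 1 := fun g => by
    have h : MonoidHom.id _ = (1 : EdgeGroup pointComplex.faces ⊥ →* _) :=
      edgeGroup_hom_ext fun u v => edge_self u
    exact DFunLike.congr_fun h g
  refine ⟨fun s _ => s.card_le_univ.trans (by simp), pathConnectedSpace_of_walks () w hT,
    vert _ (), ⟨?_⟩⟩
  let e := edgeGroupEquiv hT w fun u v h => absurd h (by simp)
  let _ : Unique (EdgeGroup pointComplex.faces ⊥) := ⟨⟨1⟩, hsub⟩
  exact e.symm.trans MulEquiv.ofUnique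

lemma kappa_of_unique {G : Type} [Group G] [Unique G] : kappa G = 0 := by
  refine le_antisymm (sInf_le ⟨Unit, _, pointComplex, isTwoComplexFor_pointComplex, ?_⟩) bot_le
  have h : {s : Finset Unit | s ∈ pointComplex.faces ∧ s.card = 2 + 1} = ∅ := by
    refine Set.eq_empty_iff_forall_notMem.2 fun s hs => ?_
    have h1 : s.card ≤ 1 := s.card_le_univ
    rw [hs.2] at h1
    omega
  rw [numSimplices, h, Set.ncard_empty, Nat.cast_zero]

lemma kappa_zmod_le {m T : ℕ} (hm : 0 < m) (h : 8 * m ^ 14 ≤ 2 ^ T) :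
    kappa (Multiplicative (ZMod m)) ≤ T := by
  rcases Nat.lt_or_ge m 2 with h2 | h2
  · obtain rfl : m = 1 := by omega
    have : Unique (Multiplicative (ZMod 1)) := inferInstanceAs (Unique (Fin 1))
    rw [kappa_of_unique]
    exact bot_le
  · obtain ⟨ε, k, rfl, hk⟩ := exists_horner_eq m h2
    refine kappa_zmod_horner_le.trans ?_
    exact_mod_cast (Nat.pow_le_pow_iff_right (by norm_num)).1 (hk.trans h)

lemma hasNoFreeFactor_of_finite {G : Type} [Group G] [Finite G] : HasNoFreeFactor G := by
  intro K _ n hn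
  refine ⟨fun e => ?_⟩
  have : Nonempty (Fin n) := ⟨⟨0, hn⟩⟩
  have h : Function.Injective fun g : FreeGroup (Fin n) => e.symm (Monoid.Coprod.inr g) :=
    e.symm.injective.comp Monoid.Coprod.inr_injective
  exact not_finite_iff_infinite.2 (inferInstanceAs (Infinite (FreeGroup (Fin n))))
    (Finite.of_injective _ h)

lemma groupClass_zmod_injective : Function.Injective
    fun m : ℕ => groupClass (Multiplicative (ZMod m)) := by
  intro m m' h
  obtain ⟨e⟩ := Quotient.exact h
  have h1 := Nat.card_congr e.groupIsoToMulEquiv.toEquiv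
  exact (Nat.card_zmod m).symm.trans (h1.trans (Nat.card_zmod m'))

lemma groupClass_zmod_mem {m T : ℕ} (hm : 0 < m) (h : 8 * m ^ 14 ≤ 2 ^ T) :
    groupClass (Multiplicative (ZMod m)) ∈ abelianGroupsUpTo T := by
  have : NeZero m := ⟨hm.ne'⟩
  exact ⟨⟨_, _, rfl, hasFreeIndex_zero hasNoFreeFactor_of_finite, kappa_zmod_le hm h⟩,
    _, _, rfl, inferInstanceAs (Finite (ZMod m)), mul_comm⟩

lemma le_ncard_abelianGroupsUpTo (T : ℕ) :
    ⌊(2 : ℝ) ^ (((T : ℝ) - 3) / 14)⌋₊ ≤ (abelianGroupsUpTo T).ncard := by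
  set N := ⌊(2 : ℝ) ^ (((T : ℝ) - 3) / 14)⌋₊ with hN
  have hsub : (fun m : ℕ => groupClass (Multiplicative (ZMod m))) '' (Finset.Icc 1 N : Finset ℕ) ⊆
      abelianGroupsUpTo T := by
    rintro _ ⟨m, hm, rfl⟩
    rw [Finset.mem_coe, Finset.mem_Icc] at hm
    refine groupClass_zmod_mem hm.1 ?_
    have h1 : (m : ℝ) ≤ (2 : ℝ) ^ (((T : ℝ) - 3) / 14) :=
      (Nat.le_floor_iff (by positivity)).1 hm.2
    have h2 : (m : ℝ) ^ 14 ≤ (2 : ℝ) ^ ((T : ℝ) - 3) := by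
      refine (pow_le_pow_left₀ (by positivity) h1 14).trans (le_of_eq ?_)
      rw [← Real.rpow_natCast, ← Real.rpow_mul (by norm_num)]
      congr 1
      push_cast
      ring
    have h3 : (8 : ℝ) * (m : ℝ) ^ 14 ≤ 2 ^ T := by
      rw [Real.rpow_sub (by norm_num), Real.rpow_natCast, le_div_iff₀ (by positivity)] at h2
      norm_num at h2
      linarith
    exact_mod_cast h3
  have h := Set.ncard_le_ncard hsub ((groupsUpTo_finite T).subset fun _ hc => hc.1)
  rwa [Set.ncard_image_of_injective _ groupClass_zmod_injective, Set.ncard_coe_finset,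
    Nat.card_Icc, Nat.add_sub_cancel] at h

end LowerBound

end SimplicialComplexity

theorem mainTheorem3 (T : ℕ) (hT : 2 ≤ T) :
    (SimplicialComplexity.groupsUpTo T).Finite ∧
    ⌊(2 : ℝ) ^ (((T : ℝ) - 3) / 14)⌋₊ ≤ (SimplicialComplexity.abelianGroupsUpTo T).ncard ∧
    (SimplicialComplexity.abelianGroupsUpTo T).ncard ≤
      (SimplicialComplexity.groupsUpTo T).ncard ∧
    ((SimplicialComplexity.groupsUpTo T).ncard : ℝ) ≤
      (2 : ℝ) ^ (6 * (T : ℝ) * Real.logb 2 (T : ℝ)) :=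
  ⟨SimplicialComplexity.groupsUpTo_finite T, SimplicialComplexity.le_ncard_abelianGroupsUpTo T,
    Set.ncard_le_ncard (fun _ hc => hc.1) (SimplicialComplexity.groupsUpTo_finite T),
    SimplicialComplexity.ncard_groupsUpTo_le_rpow hT⟩
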